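/- Turnstile model: a stream is a finite sequence of updates $(i,\Delta)\in[n]\times\mathbb Z$, each meaning $x_i\leftarrow x_i+\Delta$, where $x\in\mathbb Z^n$ starts at $0$ and $\|x\|_\infty\le M$ holds after every update; $\ell_0$ is the number of nonzero coordinates of the final $x$. An $r$-pass algorithm is given for all parameters $n$, $M$, $\varepsilon$. It reads the stream $r$ times in the same order, is told when a pass ends, flips fresh random coins at each step, and outputs a real number $Z$ that depends on its final memory. Its space is the number of bits of memory that it keeps between consecutive updates; random choices that are used again later have to be kept there too. (1) There exist absolute constants $\varepsilon_0>0$ and $C$ and a two-pass algorithm such that, for all $\varepsilon\in(0,\varepsilon_0)$, all $n$, $M$ and every such stream, $(1-\varepsilon)\ell_0\le Z\le(1+\varepsilon)\ell_0$ holds with probability at least $0.8$, and for all $M\ge 3$ the algorithm uses at most $$C\bigl(\log n+\varepsilon^{-2}\log\log M\,(\log(1/\varepsilon)+\log\log M)\bigr)$$ bits of space. (2) There exist an absolute constant $\varepsilon_0>0$ and a three-pass algorithm such that, for all $\varepsilon\in(0,\varepsilon_0)$, all $n$, $M$ and every such stream, $(1-\varepsilon)\ell_0\le Z\le(1+\varepsilon)\ell_0$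 holds with probability at least $0.75$. For every $c$ there is a $C$ such that, for all $\varepsilon\in(0,\varepsilon_0)$ and all $n$ and $M\ge3$ with $(\log\log M)^2\le c\log n$ (in particular whenever $M\le\mathrm{poly}(n)$, for suitable $c$), the algorithm uses at most $$C\bigl(\log n+\varepsilon^{-2}(\log(1/\varepsilon)+\log\log M)\bigr)$$ bits of space. (3) One pass and two passes are separated: statement (1) becomes false if "two-pass" is replaced by "one-pass". Here $\log$ is the natural logarithm (and $\log 0=0$ in the trivial case $n=0$). -/

import Mathlib

open scoped ENNReal

/-- A turnstile update `(i, Δ)`, standing for `x i ← x i + Δ`. -/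
abbrev Update (n : ℕ) : Type := Fin n × ℤ

/-- The vector described by a finite stream of updates, starting from `0`. -/
def streamVector {n : ℕ} (σ : List (Update n)) : Fin n → ℤ :=
  fun i => (σ.map fun u => if u.1 = i then u.2 else 0).sum

/-- The promise `‖x‖_∞ ≤ M` at every moment of the stream. -/
def StreamBounded {n : ℕ} (M : ℕ) (σ : List (Update n)) : Prop :=
  ∀ τ : List (Update n), τ <+: σ → ∀ i, |streamVector τ i| ≤ (M : ℤ)

/-- A randomized streaming machine on `n` coordinates whose whole memory is `bits` bits.
It flips fresh coins at every step; coins (for instance hash functions) that are needed again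
later have to be kept in the memory, and so do the results of earlier passes. -/
structure StreamMachine (n : ℕ) where
  /-- number of bits of memory -/
  bits : ℕ
  /-- random initialization of the memory -/
  init : PMF (Fin bits → Bool)
  /-- reaction of the memory to one update -/
  step : Update n → (Fin bits → Bool) → PMF (Fin bits → Bool)
  /-- reaction of the memory to the signal that a pass over the stream has ended -/
  endPass : (Fin bits → Bool) → PMF (Fin bits → Bool)
  /-- the number that is output, read off from the final contents of the memory -/
  output : (Fin bits → Bool) → ℝ

namespace StreamMachine

variable {n : ℕ} (A : StreamMachine n)

/-- Distribution of the memory after reading a list of updates, from given contents. -/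
noncomputable def readFrom : List (Update n) → (Fin A.bits → Bool) → PMF (Fin A.bits → Bool)
  | [], s => PMF.pure s
  | u :: σ, s => (A.step u s).bind (readFrom σ)

/-- Distribution of the memory after `r` passes over the same stream `σ`, in the same order. -/
noncomputable def afterPasses (σ : List (Update n)) : ℕ → PMF (Fin A.bits → Bool)
  | 0 => A.init
  | r + 1 => (afterPasses σ r).bind fun s => (A.readFrom σ s).bind A.endPass

/-- Distribution of the output after `r` passes over the stream `σ`. -/
noncomputable def outputDist (r : ℕ) (σ : List (Update n)) : PMF ℝ :=
  (A.afterPasses σ r).map A.output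

end StreamMachine

/-- A streaming algorithm: a machine for each dimension `n`, each bound `M` on the
absolute values of the coordinates and each accuracy `ε`. -/
abbrev StreamAlgorithm : Type := (n M : ℕ) → (ε : ℝ) → StreamMachine n

/-- With `r` passes and for every `ε ∈ (0, ε₀)`, the algorithm outputs on each admissible stream,
with probability at least `p`, a number `Z` with `(1 - ε) ℓ₀ ≤ Z ≤ (1 + ε) ℓ₀`.
Here `ℓ₀` is the number of nonzero coordinates of the final vector (`hammingNorm`). -/
def StreamAlgorithm.EstimatesL0 (A : StreamAlgorithm) (r : ℕ) (p ε₀ : ℝ) : Prop :=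
  ∀ (n M : ℕ) (ε : ℝ), 0 < ε → ε < ε₀ → ∀ σ : List (Update n), StreamBounded M σ →
    ENNReal.ofReal p ≤ ((A n M ε).outputDist r σ).toOuterMeasure
      {Z : ℝ | (1 - ε) * (hammingNorm (streamVector σ) : ℝ) ≤ Z ∧
        Z ≤ (1 + ε) * (hammingNorm (streamVector σ) : ℝ)}

/-- `log n + ε⁻² log log M (log (1/ε) + log log M)` -/
noncomputable def twoPassBound (n M : ℕ) (ε : ℝ) : ℝ :=
  Real.log n + (ε ^ 2)⁻¹ * Real.log (Real.log M) * (Real.log (1 / ε) + Real.log (Real.log M))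

/-- `log n + ε⁻² (log (1/ε) + log log M)` -/
noncomputable def threePassBound (n M : ℕ) (ε : ℝ) : ℝ :=
  Real.log n + (ε ^ 2)⁻¹ * (Real.log (1 / ε) + Real.log (Real.log M))

/-- There are a constant `ε₀` and an `r`-pass algorithm that is correct with probability at least
`0.8` for all `ε ∈ (0, ε₀)` and uses `O(log n + ε⁻² log log M (log (1/ε) + log log M))` bits. -/
def SolvableWithinTwoPassBound (r : ℕ) : Prop :=
  ∃ ε₀ : ℝ, 0 < ε₀ ∧ ∃ A : StreamAlgorithm, A.EstimatesL0 r 0.8 ε₀ ∧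
    ∃ C : ℝ, ∀ (n M : ℕ) (ε : ℝ), 3 ≤ M → 0 < ε → ε < ε₀ →
      ((A n M ε).bits : ℝ) ≤ C * twoPassBound n M ε

/-! Upper bounds. Reduce the vector modulo a random prime `p`. A nonzero entry has at most `log₂ M`
prime factors, so a prime with `O(log log M)` bits typically preserves half of the nonzero
coordinates, and one with `O(log (1/ε) + log log M)` bits preserves all but a fraction `ε/2`
(`card_bad_primes_le`). A bucket of level `j` samples each coordinate with probability `2⁻ʲ` and
stores a random linear combination modulo `p`. The probability that it is zero is an explicit
decreasing function of `ℓ₀` (`card_bucket_eq_zero`), with slope of order `1/ℓ₀` when `2 ^ j` is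
comparable to `ℓ₀`. So the fraction of zeros among `K = O(ε⁻²)` buckets of a suitable level
determines `ℓ₀` up to a factor `1 ± ε` (`card_bad_estimate_le`).

A suitable level is the last one with a nonzero bucket, up to constants. One bucket for each of the
`log n` levels costs too much, so the search has two scales. With primes of `s₁ = O(log log M)`
bits, a pass over every `(s₁ + 1)`-st level takes `O(log n + s₁)` bits, and a pass over the `s₁ + 1`
levels from the one found takes `O(s₁²)` bits. Three passes do the coarse search, the fine search
and the estimate one after another. Two passes merge the last two by filling `K` buckets for each
candidate level, which costs a factor `log log M`; in three passes the term `s₁²` is why `(log log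
M) ^ 2 = O(log n)` is needed. Randomness that must be remembered is cheap: by a union bound over all
vectors modulo `p`, a list of seeds of length polynomial in the parameters can replace full
independence (`exists_seeds`), and only an index into it is stored.

Lower bound. The memory of a one-pass machine in the middle of the stream is a message in a one-way
protocol for augmented indexing on `J * k` bits. Bits are written as blocks of geometrically growing
sizes, the larger ones are deleted by the query, and the queried bit then changes `ℓ₀` by a relative
amount of at least order `1/k`. With `k` of order `1/ε` this forces `J * k = O(bits)`, where `J` is
of order `log n` (`StreamMachine.EstimatesL0.le_bits`). For fixed `ε` and `M` the two-pass bound is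
only `O(log n) + O(1)`, with a constant independent of `ε` at `log n`, so a large `k` refutes it. -/

namespace StreamMachine

/-! ### Seeded deterministic machines and linear sketches -/

section Simulation

variable {n : ℕ} {S Θ : Type} [Fintype Θ] [Nonempty Θ] {A : StreamMachine n}
  {enc : S → Fin A.bits → Bool} {start : Θ → S} {step : Update n → S → S} {fin : S → S}
  {out : S → ℝ}

theorem readFrom_eq_pure (hstep : ∀ u s, A.step u (enc s) = PMF.pure (enc (step u s)))
    (σ : List (Update n)) (s : S) :
    A.readFrom σ (enc s) = PMF.pure (enc (σ.foldl (fun s u => step u s) s)) := by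
  induction σ generalizing s with
  | nil => rfl
  | cons u σ ih => rw [readFrom, hstep, PMF.pure_bind, ih, List.foldl_cons]

theorem afterPasses_eq_map_uniform
    (hinit : A.init = (PMF.uniformOfFintype Θ).map fun θ => enc (start θ))
    (hstep : ∀ u s, A.step u (enc s) = PMF.pure (enc (step u s)))
    (hfin : ∀ s, A.endPass (enc s) = PMF.pure (enc (fin s))) (σ : List (Update n)) (r : ℕ) :
    A.afterPasses σ r = (PMF.uniformOfFintype Θ).map fun θ =>
      enc ((fun s => fin (σ.foldl (fun s u => step u s) s))^[r] (start θ)) := by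
  induction r with
  | zero => exact hinit
  | succ r ih =>
    rw [afterPasses, ih, PMF.bind_map, ← PMF.bind_pure_comp]
    congr 1
    funext θ
    simp only [Function.comp_apply]
    rw [readFrom_eq_pure hstep, PMF.pure_bind, hfin, Function.iterate_succ_apply']

/-- A machine that simulates a deterministic machine with states `S`, started in a state
determined by a uniformly random seed. -/
theorem outputDist_eq_map_uniform
    (hinit : A.init = (PMF.uniformOfFintype Θ).map fun θ => enc (start θ))
    (hstep : ∀ u s, A.step u (enc s) = PMF.pure (enc (step u s)))
    (hfin : ∀ s, A.endPass (enc s) = PMF.pure (enc (fin s)))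
    (hout : ∀ s, A.output (enc s) = out s) (σ : List (Update n)) (r : ℕ) :
    A.outputDist r σ = (PMF.uniformOfFintype Θ).map fun θ =>
      out ((fun s => fin (σ.foldl (fun s u => step u s) s))^[r] (start θ)) := by
  rw [outputDist, afterPasses_eq_map_uniform hinit hstep hfin, PMF.map_comp]
  congr 1
  funext θ
  simp [hout]

end Simulation

end StreamMachine

theorem streamVector_cons {n : ℕ} (u : Update n) (σ : List (Update n)) (i : Fin n) :
    streamVector (u :: σ) i = (if u.1 = i then u.2 else 0) + streamVector σ i := by
  simp [streamVector]

theorem sum_streamVector_cons_smul {n : ℕ} {G : Type*} [AddCommGroup G] (v : Fin n → G)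
    (u : Update n) (σ : List (Update n)) :
    ∑ i, streamVector (u :: σ) i • v i = u.2 • v u.1 + ∑ i, streamVector σ i • v i := by
  simp [streamVector_cons, add_smul, Finset.sum_add_distrib, ite_smul]

/-- A protocol that in each pass computes a linear sketch of the stream vector, given a seed and
a register which is updated after each pass, can be run by a machine. -/
theorem exists_streamMachine_of_linearSketch {n : ℕ} {Θ H : Type} [Fintype Θ] [Nonempty Θ]
    [Fintype H] (Acc : Θ → Type) [∀ θ, AddCommGroup (Acc θ)] [∀ θ, Fintype (Acc θ)]
    (v : ∀ θ, H → Fin n → Acc θ) (next : ∀ θ, H → Acc θ → H) (h₀ : H) (out : Θ → H → ℝ) (b : ℕ)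
    (hb : Fintype.card (Σ θ, H × Acc θ) ≤ 2 ^ b) (r : ℕ) :
    ∃ A : StreamMachine n, A.bits = b ∧ ∀ σ, A.outputDist r σ = (PMF.uniformOfFintype Θ).map
      fun θ => out θ ((fun h => next θ h (∑ i, streamVector σ i • v θ h i))^[r] h₀) := by
  classical
  have hne : Nonempty (Σ θ, H × Acc θ) := ⟨⟨Classical.arbitrary Θ, h₀, 0⟩⟩
  obtain ⟨enc⟩ : Nonempty ((Σ θ, H × Acc θ) ↪ (Fin b → Bool)) :=
    Function.Embedding.nonempty_of_card_le (by simpa using hb)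
  have hdec := Function.leftInverse_invFun enc.injective
  refine ⟨⟨b, (PMF.uniformOfFintype Θ).map fun θ => enc ⟨θ, h₀, 0⟩,
    fun u m => PMF.pure (enc ((fun s : Σ θ, H × Acc θ =>
      (⟨s.1, s.2.1, s.2.2 + u.2 • v s.1 s.2.1 u.1⟩ : Σ θ, H × Acc θ)) (Function.invFun enc m))),
    fun m => PMF.pure (enc ((fun s : Σ θ, H × Acc θ =>
      (⟨s.1, next s.1 s.2.1 s.2.2, 0⟩ : Σ θ, H × Acc θ)) (Function.invFun enc m))),
    fun m => (fun s : Σ θ, H × Acc θ => out s.1 s.2.1) (Function.invFun enc m)⟩, rfl,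
    fun σ => ?_⟩
  rw [StreamMachine.outputDist_eq_map_uniform (enc := enc)
    (start := fun θ : Θ => (⟨θ, h₀, 0⟩ : Σ θ, H × Acc θ))
    (step := fun u s => ⟨s.1, s.2.1, s.2.2 + u.2 • v s.1 s.2.1 u.1⟩)
    (fin := fun s => ⟨s.1, next s.1 s.2.1 s.2.2, 0⟩) (out := fun s => out s.1 s.2.1) rfl
    (fun u s => congrArg (fun s : Σ θ, H × Acc θ => PMF.pure (enc
      (⟨s.1, s.2.1, s.2.2 + u.2 • v s.1 s.2.1 u.1⟩ : Σ θ, H × Acc θ))) (hdec s))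
    (fun s => congrArg (fun s : Σ θ, H × Acc θ => PMF.pure (enc
      (⟨s.1, next s.1 s.2.1 s.2.2, 0⟩ : Σ θ, H × Acc θ))) (hdec s))
    (fun s => congrArg (fun s : Σ θ, H × Acc θ => out s.1 s.2.1) (hdec s))]
  congr 1
  funext θ
  have hfold : ∀ (σ : List (Update n)) (h : H) (a : Acc θ),
      σ.foldl (fun (s : Σ θ, H × Acc θ) u =>
        (⟨s.1, s.2.1, s.2.2 + u.2 • v s.1 s.2.1 u.1⟩ : Σ θ, H × Acc θ)) ⟨θ, h, a⟩ =
      ⟨θ, h, a + ∑ i, streamVector σ i • v θ h i⟩ := by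
    intro σ
    induction σ with
    | nil => intro h a; simp [streamVector]
    | cons u σ ih =>
      intro h a
      rw [List.foldl_cons, ih, sum_streamVector_cons_smul, add_assoc]
  -- The accumulator is reset to `0` at the end of a pass, so each pass sees the sketch of the whole
  -- vector and only the register carries over.
  have hiter : ∀ r : ℕ, (fun s : Σ θ, H × Acc θ => (fun s : Σ θ, H × Acc θ =>
        (⟨s.1, next s.1 s.2.1 s.2.2, 0⟩ : Σ θ, H × Acc θ))
        (σ.foldl (fun (s : Σ θ, H × Acc θ) u =>
        (⟨s.1, s.2.1, s.2.2 + u.2 • v s.1 s.2.1 u.1⟩ : Σ θ, H × Acc θ)) s))^[r] ⟨θ, h₀, 0⟩ =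
      ⟨θ, (fun h => next θ h (∑ i, streamVector σ i • v θ h i))^[r] h₀, 0⟩ := by
    intro r
    induction r with
    | zero => rfl
    | succ r ih =>
      rw [Function.iterate_succ_apply', Function.iterate_succ_apply', ih, hfold]
      simp
  rw [hiter]

/-! ### Counting forms of probability, derandomization and Chebyshev's inequality -/

/-- The probability of an event for a function of a uniformly random seed, from a count of the
bad seeds. -/
theorem ofReal_le_toOuterMeasure_map_uniform {Θ : Type} [Fintype Θ] [Nonempty Θ] (f : Θ → ℝ)
    (E : Set ℝ) (B : Finset Θ) (hB : ∀ θ, θ ∉ B → f θ ∈ E) (p : ℝ)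
    (hp : (B.card : ℝ) ≤ (1 - p) * Fintype.card Θ) :
    ENNReal.ofReal p ≤ ((PMF.uniformOfFintype Θ).map f).toOuterMeasure E := by
  classical
  rw [PMF.toOuterMeasure_map_apply]
  have hsub : (((Finset.univ \ B : Finset Θ)) : Set Θ) ⊆ f ⁻¹' E := by
    intro θ hθ
    exact hB θ (by simpa using hθ)
  refine le_trans ?_ (MeasureTheory.measure_mono hsub)
  rw [PMF.toOuterMeasure_apply_finset]
  simp only [PMF.uniformOfFintype_apply, Finset.sum_const, nsmul_eq_mul]
  have hc : (0 : ℝ) < Fintype.card Θ := by exact_mod_cast Fintype.card_pos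
  have h1 : ((Finset.univ \ B : Finset Θ).card : ℝ) = Fintype.card Θ - B.card := by
    rw [Finset.card_sdiff_of_subset (Finset.subset_univ _),
      Nat.cast_sub (Finset.card_le_card (Finset.subset_univ _)), Finset.card_univ]
  have h2 : p ≤ ((Finset.univ \ B : Finset Θ).card : ℝ) * (Fintype.card Θ : ℝ)⁻¹ := by
    rw [← div_eq_mul_inv, le_div_iff₀ hc, h1]
    linarith
  refine (ENNReal.ofReal_le_ofReal h2).trans ?_
  rw [ENNReal.ofReal_mul (by positivity), ENNReal.ofReal_inv_of_pos hc]
  simp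

/-- Derandomization by a union bound: if every `x` is bad for at most a hundredth of the random
choices, a few choices can be fixed so that every `x` is bad for at most a twentieth of them. -/
theorem exists_seeds {X Ω : Type*} [Fintype X] [Fintype Ω] [Nonempty Ω] (bad : X → Ω → Prop)
    [∀ x, DecidablePred (bad x)] (a : ℕ) (hX : Fintype.card X ≤ 2 ^ a)
    (hbad : ∀ x, (Finset.univ.filter (bad x)).card * (100 : ℝ) ≤ Fintype.card Ω) :
    ∃ f : Fin (40 * a) → Ω, ∀ x, (Finset.univ.filter fun j => bad x (f j)).card ≤ 2 * a := by
  by_contra! hcon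
  set N : ℝ := (Fintype.card Ω : ℝ) with hN
  have hNpos : 0 < N := by rw [hN]; exact_mod_cast Fintype.card_pos
  -- Exponential moment: the product of the weights over the samples is 2 to the number of bad ones.
  -- Its mean for one `x` is at most `1.01 ^ (40 * a) ≤ 2 ^ a`, so the mean summed over `X` is at
  -- most `4 ^ a`, whereas failure for every `f` would make it at least `2 ^ (2 * a + 1)`.
  let w : X → Ω → ℝ := fun x ω => if bad x ω then 2 else 1
  have hw : ∀ x, ∑ ω, w x ω ≤ 1.01 * N := by
    intro x
    have h1 : ∀ ω, w x ω = 1 + if bad x ω then (1 : ℝ) else 0 := by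
      intro ω; simp only [w]; split_ifs <;> norm_num
    simp only [h1, Finset.sum_add_distrib, Finset.sum_const, Finset.card_univ, nsmul_eq_mul,
      mul_one, Finset.sum_boole]
    have := hbad x
    linarith
  have hwprod : ∀ (f : Fin (40 * a) → Ω) x,
      ∏ j, w x (f j) = 2 ^ (Finset.univ.filter fun j => bad x (f j)).card := by
    intro f x
    simp only [w]
    rw [Finset.prod_ite]
    simp
  have hupper : ∑ f : Fin (40 * a) → Ω, ∑ x, ∏ j, w x (f j) ≤ 2 ^ a * (1.01 * N) ^ (40 * a) := by
    rw [Finset.sum_comm]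
    calc ∑ x, ∑ f : Fin (40 * a) → Ω, ∏ j, w x (f j)
        = ∑ x, (∑ ω, w x ω) ^ (40 * a) := by simp only [Fintype.sum_pow]
      _ ≤ ∑ _x : X, (1.01 * N) ^ (40 * a) := by
          refine Finset.sum_le_sum fun x _ => pow_le_pow_left₀ ?_ (hw x) _
          exact Finset.sum_nonneg fun ω _ => by simp only [w]; split_ifs <;> norm_num
      _ ≤ 2 ^ a * (1.01 * N) ^ (40 * a) := by
          rw [Finset.sum_const, Finset.card_univ, nsmul_eq_mul]
          gcongr
          exact_mod_cast hX
  have hlower : N ^ (40 * a) * 2 ^ (2 * a + 1) ≤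
      ∑ f : Fin (40 * a) → Ω, ∑ x, ∏ j, w x (f j) := by
    calc N ^ (40 * a) * 2 ^ (2 * a + 1) = ∑ _f : Fin (40 * a) → Ω, (2 : ℝ) ^ (2 * a + 1) := by
          rw [Finset.sum_const, Finset.card_univ, nsmul_eq_mul]
          simp [hN]
      _ ≤ _ := by
          refine Finset.sum_le_sum fun f _ => ?_
          obtain ⟨x, hx⟩ := hcon f
          refine le_trans ?_ (Finset.single_le_sum (f := fun x => ∏ j, w x (f j)) (fun y _ => ?_)
            (Finset.mem_univ x))
          · rw [hwprod]
            exact pow_le_pow_right₀ one_le_two hx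
          · rw [hwprod]; positivity
  have h := hlower.trans hupper
  rw [mul_pow, mul_left_comm, mul_comm (N ^ _)] at h
  have h2 : (2 : ℝ) ^ (2 * a + 1) ≤ 2 ^ a * 1.01 ^ (40 * a) := by
    have hp : 0 < N ^ (40 * a) := by positivity
    have : (2 : ℝ) ^ (2 * a + 1) * N ^ (40 * a) ≤ 2 ^ a * 1.01 ^ (40 * a) * N ^ (40 * a) := by
      linarith
    exact le_of_mul_le_mul_right this hp
  have h3 : (1.01 : ℝ) ^ (40 * a) ≤ 2 ^ a := by
    rw [pow_mul]
    exact pow_le_pow_left₀ (by norm_num) (by norm_num) _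
  have h4 : (2 : ℝ) ^ (2 * a + 1) = 2 ^ a * 2 ^ a * 2 := by ring
  have h5 : (0 : ℝ) < 2 ^ a * 2 ^ a := by positivity
  nlinarith [mul_le_mul_of_nonneg_left h3 (by positivity : (0 : ℝ) ≤ 2 ^ a)]

/-- Cross terms of independent centred variables vanish, so the second moments add up; the induction
splits off one sample at a time. -/
theorem sum_sq_sum_le_of_sum_eq_zero {Ω : Type*} [Fintype Ω] (g : Ω → ℝ) (hg : ∑ ω, g ω = 0)
    (hg1 : ∀ ω, |g ω| ≤ 1) (K : ℕ) :
    ∑ ω : Fin K → Ω, (∑ b, g (ω b)) ^ 2 ≤ K * (Fintype.card Ω : ℝ) ^ K := by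
  induction K with
  | zero => simp
  | succ K ih =>
    rw [← (Fin.consEquiv fun _ : Fin (K + 1) => Ω).sum_comp, Fintype.sum_prod_type]
    have hexp : ∀ (w : Ω) (ω : Fin K → Ω),
        (∑ b, g ((Fin.consEquiv fun _ : Fin (K + 1) => Ω) (w, ω) b)) ^ 2 =
          g w ^ 2 + g w * (2 * ∑ b, g (ω b)) + (∑ b, g (ω b)) ^ 2 := by
      intro w ω
      rw [Fin.sum_univ_succ]
      simp only [Fin.consEquiv, Equiv.coe_fn_mk, Fin.cons_zero, Fin.cons_succ]
      ring
    simp only [hexp, Finset.sum_add_distrib, ← Finset.mul_sum, ← Finset.sum_mul, hg, zero_mul,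
      add_zero, Finset.sum_const, Finset.card_univ, nsmul_eq_mul, Fintype.card_fun,
      Fintype.card_fin, Nat.cast_pow]
    have h1 : ∑ w, g w ^ 2 ≤ Fintype.card Ω := by
      calc ∑ w, g w ^ 2 ≤ ∑ _w : Ω, (1 : ℝ) :=
            Finset.sum_le_sum fun w _ => (sq_le_one_iff_abs_le_one _).2 (hg1 w)
        _ = _ := by simp
    push_cast
    have hc : (0 : ℝ) ≤ Fintype.card Ω := by positivity
    calc (Fintype.card Ω : ℝ) ^ K * ∑ w, g w ^ 2
          + Fintype.card Ω * ∑ ω : Fin K → Ω, (∑ b, g (ω b)) ^ 2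
        ≤ (Fintype.card Ω : ℝ) ^ K * Fintype.card Ω
          + Fintype.card Ω * (K * (Fintype.card Ω : ℝ) ^ K) := by gcongr
      _ = _ := by ring

/-- Chebyshev's inequality for the fraction of `K` independent samples that satisfy `P`. -/
theorem card_deviation_mul_le {Ω : Type*} [Fintype Ω] (P : Ω → Prop) [DecidablePred P]
    (f : ℝ) (hf : ((Finset.univ.filter P).card : ℝ) = Fintype.card Ω * f) (hf0 : 0 ≤ f)
    (hf1 : f ≤ 1) (K : ℕ) (hK : 0 < K) (η : ℝ) (hη : 0 < η) :
    ((Finset.univ.filter fun ω : Fin K → Ω =>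
      η < |((Finset.univ.filter fun b => P (ω b)).card : ℝ) / K - f|).card : ℝ) * (K * η ^ 2) ≤
      Fintype.card (Fin K → Ω) := by
  let g : Ω → ℝ := fun w => (if P w then 1 else 0) - f
  have hg : ∑ w, g w = 0 := by
    simp only [g, Finset.sum_sub_distrib, Finset.sum_boole, hf, Finset.sum_const,
      Finset.card_univ, nsmul_eq_mul, sub_self]
  have hg1 : ∀ w, |g w| ≤ 1 := by
    intro w
    simp only [g]
    rw [abs_le]
    split_ifs <;> constructor <;> linarith
  have hK' : (0 : ℝ) < K := by exact_mod_cast hK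
  have hS : ∀ ω : Fin K → Ω, ∑ b, g (ω b) =
      K * (((Finset.univ.filter fun b => P (ω b)).card : ℝ) / K - f) := by
    intro ω
    simp only [g, Finset.sum_sub_distrib, Finset.sum_boole, Finset.sum_const, Finset.card_univ,
      nsmul_eq_mul, Fintype.card_fin]
    field_simp
  have key := sum_sq_sum_le_of_sum_eq_zero g hg hg1 K
  set B := Finset.univ.filter fun ω : Fin K → Ω =>
      η < |((Finset.univ.filter fun b => P (ω b)).card : ℝ) / K - f| with hB
  have h2 : (B.card : ℝ) * (K * η) ^ 2 ≤ ∑ ω : Fin K → Ω, (∑ b, g (ω b)) ^ 2 := by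
    rw [← nsmul_eq_mul]
    refine le_trans ?_ (Finset.sum_le_sum_of_subset_of_nonneg (Finset.subset_univ B)
      fun _ _ _ => sq_nonneg _)
    refine Finset.card_nsmul_le_sum _ _ _ fun ω hω => ?_
    rw [hS, mul_pow, mul_pow]
    have hω' : η < |((Finset.univ.filter fun b => P (ω b)).card : ℝ) / K - f| :=
      (Finset.mem_filter.1 hω).2
    rw [← sq_abs (_ - f)]
    gcongr
  have h3 : (K : ℝ) * ((B.card : ℝ) * (K * η ^ 2)) ≤ K * (Fintype.card Ω : ℝ) ^ K := by
    nlinarith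
  have h4 := le_of_mul_le_mul_left h3 hK'
  simpa using h4

theorem addChar_sum_eq_prod {A M ι : Type*} [AddCommMonoid A] [CommMonoid M] (ψ : AddChar A M)
    (s : Finset ι) (f : ι → A) : ψ (∑ i ∈ s, f i) = ∏ i ∈ s, ψ (f i) := by
  classical
  induction s using Finset.induction_on with
  | empty => simp
  | insert i s hi ih =>
    rw [Finset.sum_insert hi, Finset.prod_insert hi, AddChar.map_add_eq_mul, ih]

/-! ### Buckets and the exact probability that they are zero -/

section Bucket

variable {n p : ℕ}

/-- The coefficient of a coordinate in a bucket of level `j`: with probability `2⁻ʲ` it is uniformly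
random, and else it is `0`. -/
def sampledCoeff (L j : ℕ) (w : Fin (2 ^ L) × ZMod p) : ZMod p :=
  if (w.1 : ℕ) < 2 ^ (L - j) then w.2 else 0

/-- The contents of a bucket of level `j`. -/
def bucket (L j : ℕ) (x : Fin n → ZMod p) (ω : Fin n → Fin (2 ^ L) × ZMod p) : ZMod p :=
  ∑ i, x i * sampledCoeff L j (ω i)

/-- The probability that a bucket of level `j` is zero for a vector with `l` nonzero coordinates. -/
noncomputable def zeroProb (p j l : ℕ) : ℝ := 1 / p + (1 - 1 / p) * (1 - (1 / 2) ^ j) ^ l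

/-- If the coordinate is sampled, its coefficient is uniform and a nontrivial character averages to
`0`; if not, the character is `1`. What remains for `y ≠ 0` is the probability of not being sampled.
-/
theorem sum_addChar_sampledCoeff [Fact p.Prime] {L j : ℕ} (hj : j ≤ L) {ψ : AddChar (ZMod p) ℂ}
    (hψ : ψ.IsPrimitive) (y : ZMod p) :
    ∑ w : Fin (2 ^ L) × ZMod p, ψ (y * sampledCoeff L j w) =
      (2 ^ L * p) * if y = 0 then 1 else (1 - (1 / 2) ^ j) := by
  classical
  have hsplit : (2 : ℂ) ^ (L - j) = 2 ^ L * (1 / 2) ^ j := by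
    rw [pow_sub₀ _ two_ne_zero hj, one_div, inv_pow]
  by_cases hy : y = 0
  · simp [hy]
  · rw [Fintype.sum_prod_type, if_neg hy]
    have h1 : ∀ u : Fin (2 ^ L), ∑ a : ZMod p, ψ (y * sampledCoeff L j (u, a)) =
        if (u : ℕ) < 2 ^ (L - j) then 0 else (p : ℂ) := by
      intro u
      unfold sampledCoeff
      split_ifs with hu
      · have := AddChar.sum_mulShift y hψ
        simpa [hy, mul_comm] using this
      · simp [ZMod.card]
    simp only [h1]
    have h2 : (Finset.univ.filter fun u : Fin (2 ^ L) => (u : ℕ) < 2 ^ (L - j)).card =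
        2 ^ (L - j) := by
      rw [Fin.card_filter_val_lt]
      exact min_eq_right (Nat.pow_le_pow_right two_pos (Nat.sub_le _ _))
    have h3 : ∀ u : Fin (2 ^ L), (if (u : ℕ) < 2 ^ (L - j) then 0 else (p : ℂ)) =
        p - p * (if (u : ℕ) < 2 ^ (L - j) then 1 else 0) := by
      intro u; split_ifs <;> simp
    simp only [h3, Finset.sum_sub_distrib, ← Finset.mul_sum, Finset.sum_boole, h2]
    simp only [Finset.sum_const, Finset.card_univ, Fintype.card_fin, nsmul_eq_mul]
    push_cast
    rw [hsplit]
    ring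

/-- Fourier inversion: the indicator of a zero bucket is the average over `s` of `ψ (s * bucket)`.
The coordinates are independent, so the mean of each character factorizes. The term `s = 0` gives `1
/ p`, and each other `s` gives one factor `1 - 2⁻ʲ` per nonzero coordinate. -/
theorem card_bucket_eq_zero [Fact p.Prime] {L j : ℕ} (hj : j ≤ L) (x : Fin n → ZMod p) :
    ((Finset.univ.filter fun ω => bucket L j x ω = 0).card : ℝ) =
      Fintype.card (Fin n → Fin (2 ^ L) × ZMod p) * zeroProb p j (hammingNorm x) := by
  classical
  have hψ : (ZMod.stdAddChar (N := p)).IsPrimitive := ZMod.isPrimitive_stdAddChar p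
  set ψ : AddChar (ZMod p) ℂ := ZMod.stdAddChar
  have hp0 : (p : ℂ) ≠ 0 := by exact_mod_cast (Fact.out : p.Prime).ne_zero
  have hchar : ∀ s : ZMod p, ∑ ω : Fin n → Fin (2 ^ L) × ZMod p, ψ (s * bucket L j x ω) =
      (2 ^ L * p) ^ n * if s = 0 then 1 else (1 - (1 / 2) ^ j) ^ hammingNorm x := by
    intro s
    have h1 : ∀ ω : Fin n → Fin (2 ^ L) × ZMod p, ψ (s * bucket L j x ω) =
        ∏ i, ψ ((s * x i) * sampledCoeff L j (ω i)) := by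
      intro ω
      rw [bucket, Finset.mul_sum]
      simp only [mul_assoc]
      exact addChar_sum_eq_prod ψ _ _
    simp only [h1]
    have h2 := Finset.prod_univ_sum (fun _ : Fin n => (Finset.univ : Finset (Fin (2 ^ L) × ZMod p)))
      (fun i w => ψ ((s * x i) * sampledCoeff L j w))
    rw [Fintype.piFinset_univ] at h2
    rw [← h2]
    simp only [sum_addChar_sampledCoeff hj hψ, Finset.prod_mul_distrib, Finset.prod_const,
      Finset.card_univ, Fintype.card_fin]
    rw [← mul_pow]
    congr 1
    by_cases hs : s = 0
    · simp [hs]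
    · rw [if_neg hs, Finset.prod_ite]
      simp [hammingNorm, hs]
  have hcount : (p : ℂ) * (Finset.univ.filter fun ω => bucket L j x ω = 0).card =
      (2 ^ L * p) ^ n * (1 + (p - 1) * (1 - (1 / 2) ^ j) ^ hammingNorm x) := by
    have h1 : (p : ℂ) * (Finset.univ.filter fun ω => bucket L j x ω = 0).card =
        ∑ ω : Fin n → Fin (2 ^ L) × ZMod p, ∑ s, ψ (s * bucket L j x ω) := by
      simp only [AddChar.sum_mulShift _ hψ, ZMod.card]
      rw [← Finset.sum_boole, Finset.mul_sum]
      simp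
    rw [h1, Finset.sum_comm]
    simp only [hchar, ← Finset.mul_sum]
    congr 1
    rw [← Finset.add_sum_erase _ _ (Finset.mem_univ (0 : ZMod p))]
    rw [Finset.sum_congr rfl (g := fun _ => (1 - (1 / 2 : ℂ) ^ j) ^ hammingNorm x)
      fun s hs => by simp [Finset.ne_of_mem_erase hs]]
    rw [Finset.sum_const, Finset.card_erase_of_mem (Finset.mem_univ _), Finset.card_univ, ZMod.card,
      nsmul_eq_mul, Nat.cast_sub (Fact.out : p.Prime).one_le]
    simp
  have hreal : (((Finset.univ.filter fun ω => bucket L j x ω = 0).card : ℝ) : ℂ) =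
      ((Fintype.card (Fin n → Fin (2 ^ L) × ZMod p) * zeroProb p j (hammingNorm x) : ℝ) : ℂ) := by
    rw [← mul_right_inj' hp0, Complex.ofReal_natCast, hcount]
    simp only [zeroProb, Fintype.card_fun, Fintype.card_prod, Fintype.card_fin, ZMod.card]
    push_cast
    field_simp
  exact_mod_cast hreal

end Bucket

/-! ### Monotonicity and slope of the zero probability -/

section ZeroProb

variable {p : ℕ} {q : ℝ}

/-- Bernoulli's inequality turns the product into at most `(1 - q ^ 2) ^ l`. This replaces
exponential estimates in both directions below. -/
theorem one_sub_pow_mul_one_add_le (hq0 : 0 ≤ q) (hq1 : q ≤ 1) (l : ℕ) :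
    (1 - q) ^ l * (1 + l * q) ≤ 1 := by
  have h1 : (1 + l * q) ≤ (1 + q) ^ l := one_add_mul_le_pow (by linarith) l
  calc (1 - q) ^ l * (1 + l * q) ≤ (1 - q) ^ l * (1 + q) ^ l := by
        have : 0 ≤ (1 - q) ^ l := pow_nonneg (by linarith) l
        gcongr
    _ = (1 - q ^ 2) ^ l := by rw [← mul_pow]; ring
    _ ≤ 1 := pow_le_one₀ (by nlinarith) (by nlinarith)

theorem one_sub_pow_le_one (hq0 : 0 ≤ q) (hq1 : q ≤ 1) (l : ℕ) : (1 - q) ^ l ≤ 1 :=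
  pow_le_one₀ (by linarith) (by linarith)

theorem half_pow_mem (j : ℕ) : 0 < (1 / 2 : ℝ) ^ j ∧ (1 / 2 : ℝ) ^ j ≤ 1 :=
  ⟨by positivity, pow_le_one₀ (by norm_num) (by norm_num)⟩

theorem one_div_prime_mem [Fact p.Prime] : 0 < (1 / p : ℝ) ∧ (1 / p : ℝ) ≤ 1 / 2 := by
  have h2 : (2 : ℝ) ≤ p := by exact_mod_cast (Fact.out : p.Prime).two_le
  exact ⟨by positivity, one_div_le_one_div_of_le two_pos h2⟩

theorem zeroProb_nonneg [Fact p.Prime] (j l : ℕ) : 0 ≤ zeroProb p j l := by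
  obtain ⟨h1, h2⟩ := one_div_prime_mem (p := p)
  have := pow_nonneg (sub_nonneg.2 (half_pow_mem j).2) l
  unfold zeroProb
  nlinarith

theorem zeroProb_le_one [Fact p.Prime] (j l : ℕ) : zeroProb p j l ≤ 1 := by
  obtain ⟨h1, h2⟩ := one_div_prime_mem (p := p)
  have := one_sub_pow_le_one (half_pow_mem j).1.le (half_pow_mem j).2 l
  unfold zeroProb
  nlinarith

theorem one_sub_le_zeroProb [Fact p.Prime] (j l : ℕ) : 1 - l * (1 / 2) ^ j ≤ zeroProb p j l := by
  obtain ⟨h1, h2⟩ := one_div_prime_mem (p := p)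
  obtain ⟨h3, h4⟩ := half_pow_mem j
  have h5 := one_sub_pow_le_one h3.le h4 l
  have h6 : 1 + l * -((1 : ℝ) / 2) ^ j ≤ (1 + -(1 / 2) ^ j) ^ l :=
    one_add_mul_le_pow (by linarith) l
  rw [← sub_eq_add_neg] at h6
  unfold zeroProb
  nlinarith

theorem zeroProb_le [Fact p.Prime] (j l : ℕ) :
    zeroProb p j l ≤ 1 / p + 1 / (1 + l * (1 / 2) ^ j) := by
  obtain ⟨h1, h2⟩ := one_div_prime_mem (p := p)
  obtain ⟨h3, h4⟩ := half_pow_mem j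
  have h5 := one_sub_pow_mul_one_add_le h3.le h4 l
  have h6 : (1 - (1 / 2 : ℝ) ^ j) ^ l ≤ 1 / (1 + l * (1 / 2) ^ j) := by
    rw [le_div_iff₀ (by positivity)]
    exact h5
  have h7 := pow_nonneg (sub_nonneg.2 h4) l
  unfold zeroProb
  nlinarith

theorem zeroProb_zero (j : ℕ) : zeroProb p j 0 = 1 := by simp [zeroProb]

/-- The right-hand side increases with `j`, because `1 - q ≤ (1 - q / 2) ^ 2`, and it equals `1 / 4`
at `j = 1`. At `j = 0` it would vanish, which is why all levels in use start at `1`. -/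
theorem one_sub_half_pow_pow_ge {j : ℕ} (hj : 1 ≤ j) :
    (1 / 4 : ℝ) ≤ (1 - (1 / 2) ^ j) ^ (2 ^ j) := by
  induction j, hj using Nat.le_induction with
  | base => norm_num
  | succ j hj ih =>
    obtain ⟨h3, h4⟩ := half_pow_mem j
    refine ih.trans ?_
    rw [pow_succ 2 j, mul_comm (2 ^ j) 2, pow_mul]
    refine pow_le_pow_left₀ (by linarith) ?_ _
    have h5 : (1 / 2 : ℝ) ^ (j + 1) = (1 / 2) ^ j / 2 := by ring
    rw [h5]
    nlinarith [sq_nonneg ((1 / 2 : ℝ) ^ j)]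

/-- If `l` is within a factor `A` of `2 ^ j` then `zeroProb p j` separates `l` from smaller
numbers. -/
theorem le_of_zeroProb_sub_le [Fact p.Prime] {A j k l : ℕ} {ε : ℝ} (hj : 1 ≤ j)
    (hl : l ≤ A * 2 ^ j) (hl' : 2 ^ j ≤ A * l) (hk : k ≤ l)
    (h : zeroProb p j k - zeroProb p j l ≤ (1 / 4) ^ A / (4 * A) * ε) :
    (1 - ε / 2) * l ≤ k := by
  obtain ⟨d, rfl⟩ := Nat.exists_eq_add_of_le hk
  obtain ⟨h1, h2⟩ := one_div_prime_mem (p := p)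
  obtain ⟨h3, h4⟩ := half_pow_mem j
  set q : ℝ := (1 / 2) ^ j with hq
  have hA : (0 : ℝ) < A := by
    rcases Nat.eq_zero_or_pos A with rfl | hA
    · have := Nat.one_le_two_pow (n := j)
      omega
    · exact_mod_cast hA
  have hqpow : (2 : ℝ) ^ j * q = 1 := by
    rw [hq, ← mul_pow]; norm_num
  -- As `l ≤ A * 2 ^ j`, the power has not yet decayed below a constant, so losing `d` coordinates
  -- changes it by at least a constant times `d * q`.
  have h5 : (1 / 4 : ℝ) ^ A ≤ (1 - q) ^ (k + d) := by
    calc (1 / 4 : ℝ) ^ A ≤ ((1 - q) ^ (2 ^ j)) ^ A :=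
          pow_le_pow_left₀ (by norm_num) (one_sub_half_pow_pow_ge hj) _
      _ = (1 - q) ^ (A * 2 ^ j) := by rw [← pow_mul, mul_comm]
      _ ≤ (1 - q) ^ (k + d) := pow_le_pow_of_le_one (by linarith) (by linarith) hl
  have h6 := one_sub_pow_mul_one_add_le h3.le h4 d
  have h7 : (1 - q) ^ (k + d) * (d * q) ≤ (1 - q) ^ k - (1 - q) ^ (k + d) := by
    have h8 := pow_nonneg (sub_nonneg.2 h4) k
    rw [pow_add]
    nlinarith
  have h9 : (1 / 4 : ℝ) ^ A * (d * q) ≤ (1 - q) ^ k - (1 - q) ^ (k + d) :=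
    le_trans (mul_le_mul_of_nonneg_right h5 (by positivity)) h7
  have h10 : (1 / 2) * ((1 / 4 : ℝ) ^ A * (d * q)) ≤ (1 / 4) ^ A / (4 * A) * ε := by
    refine le_trans ?_ h
    have : zeroProb p j k - zeroProb p j (k + d) =
        (1 - 1 / p) * ((1 - q) ^ k - (1 - q) ^ (k + d)) := by
      unfold zeroProb; ring
    rw [this]
    have h11 : 0 ≤ (1 / 4 : ℝ) ^ A * (d * q) := by positivity
    have h12 : 0 ≤ (1 - q) ^ k - (1 - q) ^ (k + d) := h11.trans h9
    nlinarith
  have h13 : (d : ℝ) * q ≤ ε / (2 * A) := by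
    have h14 : (0 : ℝ) < (1 / 4) ^ A := by positivity
    have h15 : (1 / 2) * ((1 / 4 : ℝ) ^ A * (d * q)) = (1 / 4) ^ A * ((d * q) / 2) := by ring
    have h16 : (1 / 4 : ℝ) ^ A / (4 * A) * ε = (1 / 4) ^ A * (ε / (2 * A) / 2) := by
      field_simp; ring
    rw [h15, h16] at h10
    have := le_of_mul_le_mul_left h10 h14
    linarith
  have h17 : (2 : ℝ) ^ j ≤ A * ((k + d : ℕ) : ℝ) := by exact_mod_cast hl'
  have h18 : (d : ℝ) ≤ ε / (2 * A) * 2 ^ j := by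
    calc (d : ℝ) = (d * q) * 2 ^ j := by rw [mul_assoc, mul_comm q, hqpow, mul_one]
      _ ≤ _ := by gcongr
  have h19 : 0 ≤ ε / (2 * A) := le_trans (by positivity) h13
  have h20 : (d : ℝ) ≤ ε / 2 * ((k + d : ℕ) : ℝ) := by
    calc (d : ℝ) ≤ ε / (2 * A) * (A * ((k + d : ℕ) : ℝ)) := h18.trans (by gcongr)
      _ = _ := by field_simp
  push_cast at h20 ⊢
  linarith

end ZeroProb

/-! ### The estimate from the fraction of zero buckets -/

section Estimate

/-- The least number of nonzero coordinates that is consistent, up to `η`, with a fraction `z` of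
zero buckets at level `j`. -/
noncomputable def invZeroProb (p j : ℕ) (η z : ℝ) : ℕ := sInf {l | |zeroProb p j l - z| ≤ η}

/-- The true `l` is itself consistent with `z`, so the least consistent number cannot exceed it;
both lie within `η` of `z`, and the slope bound turns the gap `2 * η` into a relative error `ε / 2`.
-/
theorem invZeroProb_mem {p : ℕ} [Fact p.Prime] {A j l : ℕ} {ε z : ℝ} (hj : 1 ≤ j)
    (hl : l ≤ A * 2 ^ j) (hl' : 2 ^ j ≤ A * l)
    (hz : |zeroProb p j l - z| ≤ (1 / 4) ^ A / (8 * A) * ε) :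
    (1 - ε / 2) * l ≤ invZeroProb p j ((1 / 4) ^ A / (8 * A) * ε) z ∧
      invZeroProb p j ((1 / 4) ^ A / (8 * A) * ε) z ≤ l := by
  set η : ℝ := (1 / 4) ^ A / (8 * A) * ε
  have h1 : invZeroProb p j η z ≤ l := Nat.sInf_le hz
  have h2 : |zeroProb p j (invZeroProb p j η z) - z| ≤ η :=
    Nat.sInf_mem (s := {l | |zeroProb p j l - z| ≤ η}) ⟨l, hz⟩
  refine ⟨le_of_zeroProb_sub_le (p := p) hj hl hl' h1 ?_, h1⟩
  have h3 : (1 / 4 : ℝ) ^ A / (4 * A) * ε = 2 * η := by simp only [η]; ring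
  rw [h3]
  rw [abs_le] at h2 hz
  linarith

variable {n p : ℕ}

/-- The fraction of buckets of level `j` that are zero. -/
noncomputable def zeroFraction {K : ℕ} (y : Fin K → ZMod p) : ℝ :=
  ((Finset.univ.filter fun b => y b = 0).card : ℝ) / K

theorem card_bad_estimate_le [Fact p.Prime] {L j A K : ℕ} {ε : ℝ} (hε : 0 < ε) (hA : 0 < A)
    (hj1 : 1 ≤ j) (hjL : j ≤ L) (hK0 : 0 < K)
    (hK : 100 ≤ K * ((1 / 4) ^ A / (8 * A) * ε) ^ 2) (x : Fin n → ZMod p)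
    (hx : hammingNorm x ≠ 0 → hammingNorm x ≤ A * 2 ^ j ∧ 2 ^ j ≤ A * hammingNorm x) :
    ((Finset.univ.filter fun ω : Fin K → Fin n → Fin (2 ^ L) × ZMod p =>
      ¬ ((1 - ε / 2) * hammingNorm x ≤ invZeroProb p j ((1 / 4) ^ A / (8 * A) * ε)
          (zeroFraction fun b => bucket L j x (ω b)) ∧
        invZeroProb p j ((1 / 4) ^ A / (8 * A) * ε)
          (zeroFraction fun b => bucket L j x (ω b)) ≤ hammingNorm x)).card : ℝ) * 100 ≤
      Fintype.card (Fin K → Fin n → Fin (2 ^ L) × ZMod p) := by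
  classical
  have hη : 0 < (1 / 4 : ℝ) ^ A / (8 * A) * ε := by
    have : (0 : ℝ) < A := by exact_mod_cast hA
    positivity
  have hdev := card_deviation_mul_le (Ω := Fin n → Fin (2 ^ L) × ZMod p)
    (fun ω => bucket L j x ω = 0) _ (card_bucket_eq_zero hjL x) (zeroProb_nonneg _ _)
    (zeroProb_le_one _ _) K hK0 _ hη
  refine le_trans ?_ hdev
  refine mul_le_mul ?_ hK (by norm_num) (by positivity)
  refine Nat.cast_le.2 (Finset.card_le_card fun ω hω => ?_)
  rw [Finset.mem_filter] at hω ⊢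
  refine ⟨Finset.mem_univ _, ?_⟩
  by_contra hcon
  refine hω.2 ?_
  rw [not_lt, abs_sub_comm] at hcon
  -- For the zero vector every bucket is zero, and `0` is consistent at any level, so nothing is
  -- required of `j` there.
  rcases Nat.eq_zero_or_pos (hammingNorm x) with h0 | h0
  · have hx0 : x = 0 := hammingNorm_eq_zero.1 h0
    have hz : (zeroFraction fun b => bucket L j x (ω b)) = 1 := by
      have : (K : ℝ) ≠ 0 := by exact_mod_cast hK0.ne'
      simp [zeroFraction, hx0, bucket, this]
    have h1 : invZeroProb p j ((1 / 4) ^ A / (8 * A) * ε) 1 ≤ 0 :=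
      Nat.sInf_le (by simp only [Set.mem_ofPred_eq, zeroProb_zero, sub_self, abs_zero]; exact hη.le)
    rw [hz, h0]
    exact ⟨by simp, h1⟩
  · obtain ⟨h1, h2⟩ := hx h0.ne'
    exact invZeroProb_mem hj1 h1 h2 hcon

end Estimate

/-! ### Finding the level by a coarse and a fine search -/

section LevelSelection

variable {n p : ℕ}

/-- The last index of a nonzero entry, and `0` if there is none. -/
noncomputable def topNonzero {m : ℕ} (y : Fin (m + 1) → ZMod p) : Fin (m + 1) :=
  (Finset.univ.filter fun i => y i ≠ 0).sup id

theorem le_topNonzero {m : ℕ} {y : Fin (m + 1) → ZMod p} {i : Fin (m + 1)} (h : y i ≠ 0) :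
    i ≤ topNonzero y :=
  Finset.le_sup (f := id) (by simpa using h)

theorem topNonzero_eq_zero_or {m : ℕ} (y : Fin (m + 1) → ZMod p) :
    topNonzero y = 0 ∨ y (topNonzero y) ≠ 0 := by
  rcases Finset.eq_empty_or_nonempty (Finset.univ.filter fun i => y i ≠ 0) with h | h
  · left; rw [topNonzero, h]; rfl
  · right
    obtain ⟨i, hi, h⟩ := Finset.exists_mem_eq_sup _ h id
    rw [topNonzero, h]
    simpa using hi

/-- The first approximation to the level, from every `(m + 1)`-st level. -/
noncomputable def coarseLevel (L m a : ℕ) (x : Fin n → ZMod p) (ω : Fin n → Fin (2 ^ L) × ZMod p) : Fin (a + 1) :=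
  topNonzero fun h => bucket L ((m + 1) * h + 1) x ω

/-- The second approximation to the level, from the `m + 1` levels that follow the first one. -/
noncomputable def fineLevel (L m : ℕ) {a : ℕ} (x : Fin n → ZMod p) (ω : Fin n → Fin (2 ^ L) × ZMod p)
    (h : Fin (a + 1)) : Fin (m + 1) :=
  topNonzero fun r => bucket L ((m + 1) * h + 1 + r) x ω

/-- The level for the final estimate. -/
noncomputable def selectedLevel (L m a : ℕ) (x : Fin n → ZMod p) (ω : Fin n → Fin (2 ^ L) × ZMod p) : ℕ :=
  (m + 1) * coarseLevel L m a x ω + 1 + fineLevel L m x ω (coarseLevel L m a x ω)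

theorem sum_Ico_half_pow_le (a b : ℕ) :
    ∑ j ∈ Finset.Ico a b, (1 / 2 : ℝ) ^ j ≤ 2 * (1 / 2) ^ a := by
  rcases le_total b a with h | h
  · rw [Finset.Ico_eq_empty_of_le h, Finset.sum_empty]; positivity
  · have : ∑ j ∈ Finset.Ico a b, (1 / 2 : ℝ) ^ j = 2 * (1 / 2) ^ a - 2 * (1 / 2) ^ b := by
      induction b, h using Nat.le_induction with
      | base => simp
      | succ b hb ih => rw [Finset.sum_Ico_succ_top hb, ih, pow_succ]; ring
    rw [this]
    have : (0 : ℝ) < (1 / 2) ^ b := by positivity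
    linarith

theorem card_bucket_ne_zero_le [Fact p.Prime] {L j : ℕ} (hj : j ≤ L) (x : Fin n → ZMod p) :
    ((Finset.univ.filter fun ω => bucket L j x ω ≠ 0).card : ℝ) ≤
      Fintype.card (Fin n → Fin (2 ^ L) × ZMod p) * (hammingNorm x * (1 / 2) ^ j) := by
  have h1 := card_bucket_eq_zero hj x
  have h2 := Finset.card_filter_add_card_filter_not (s := (Finset.univ : Finset (Fin n → Fin (2 ^ L) × ZMod p)))
    (fun ω => bucket L j x ω = 0)
  have h3 : ((Finset.univ.filter fun ω => bucket L j x ω = 0).card : ℝ) +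
      (Finset.univ.filter fun ω => bucket L j x ω ≠ 0).card =
      Fintype.card (Fin n → Fin (2 ^ L) × ZMod p) := by exact_mod_cast h2
  have h4 := one_sub_le_zeroProb (p := p) j (hammingNorm x)
  have h5 : (0 : ℝ) ≤ Fintype.card (Fin n → Fin (2 ^ L) × ZMod p) := by positivity
  nlinarith

theorem card_bucket_eq_zero_le [Fact p.Prime] (hp : 1000 ≤ p) {L j : ℕ} (hj : j ≤ L)
    (x : Fin n → ZMod p) (hx : 1000 * 2 ^ j ≤ hammingNorm x) :
    ((Finset.univ.filter fun ω => bucket L j x ω = 0).card : ℝ) ≤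
      Fintype.card (Fin n → Fin (2 ^ L) × ZMod p) * (1 / 500) := by
  rw [card_bucket_eq_zero hj x]
  refine mul_le_mul_of_nonneg_left ((zeroProb_le _ _).trans ?_) (by positivity)
  have h1 : (1000 : ℝ) ≤ p := by exact_mod_cast hp
  have h2 : (1000 : ℝ) * 2 ^ j ≤ hammingNorm x := by exact_mod_cast hx
  have h3 : (1000 : ℝ) ≤ 1 + hammingNorm x * (1 / 2) ^ j := by
    have : (1000 : ℝ) * 2 ^ j * (1 / 2) ^ j ≤ hammingNorm x * (1 / 2) ^ j := by gcongr
    rw [mul_assoc, ← mul_pow] at this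
    norm_num at this ⊢
    linarith
  have h4 := one_div_le_one_div_of_le (by norm_num) h1
  have h5 := one_div_le_one_div_of_le (by norm_num) h3
  norm_num at h4 h5 ⊢
  linarith

/-- A union bound over all levels that are too high costs nothing extra, since the probabilities `l
* 2⁻ʲ` form a geometric series dominated by its first term. -/
theorem card_exists_bucket_ne_zero_le [Fact p.Prime] (L : ℕ) (x : Fin n → ZMod p)
    (hx : hammingNorm x ≠ 0) :
    ((Finset.univ.filter fun ω => ∃ j ≤ L, 1000 * hammingNorm x < 2 ^ j ∧
      bucket L j x ω ≠ 0).card : ℝ) ≤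
      Fintype.card (Fin n → Fin (2 ^ L) × ZMod p) * (1 / 500) := by
  classical
  set l := hammingNorm x
  set j₂ := Nat.log 2 (1000 * l) + 1
  have hsub : (Finset.univ.filter fun ω => ∃ j ≤ L, 1000 * l < 2 ^ j ∧ bucket L j x ω ≠ 0) ⊆
      (Finset.Ico j₂ (L + 1)).biUnion fun j => Finset.univ.filter fun ω => bucket L j x ω ≠ 0 := by
    intro ω hω
    obtain ⟨j, hj, hl, hb⟩ := (Finset.mem_filter.1 hω).2
    refine Finset.mem_biUnion.2 ⟨j, Finset.mem_Ico.2 ⟨?_, by omega⟩, by simpa using hb⟩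
    exact Nat.log_lt_of_lt_pow (by omega) hl
  have h1 : (1000 * l : ℝ) < 2 ^ j₂ := by
    exact_mod_cast Nat.lt_pow_succ_log_self (b := 2) (by norm_num) (1000 * l)
  have h2 : (l : ℝ) * (1 / 2) ^ j₂ ≤ 1 / 1000 := by
    have : (1000 * l : ℝ) * (1 / 2) ^ j₂ ≤ 2 ^ j₂ * (1 / 2) ^ j₂ := by gcongr
    rw [← mul_pow] at this
    norm_num at this ⊢
    linarith
  calc ((Finset.univ.filter fun ω => ∃ j ≤ L, 1000 * l < 2 ^ j ∧ bucket L j x ω ≠ 0).card : ℝ)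
      ≤ ∑ j ∈ Finset.Ico j₂ (L + 1),
          ((Finset.univ.filter fun ω => bucket L j x ω ≠ 0).card : ℝ) := by
        exact_mod_cast (Finset.card_le_card hsub).trans Finset.card_biUnion_le
    _ ≤ ∑ j ∈ Finset.Ico j₂ (L + 1),
          Fintype.card (Fin n → Fin (2 ^ L) × ZMod p) * (l * (1 / 2 : ℝ) ^ j) :=
        Finset.sum_le_sum fun j hj => card_bucket_ne_zero_le
          (by have := (Finset.mem_Ico.1 hj).2; omega) x
    _ = Fintype.card (Fin n → Fin (2 ^ L) × ZMod p) *
          (l * ∑ j ∈ Finset.Ico j₂ (L + 1), (1 / 2 : ℝ) ^ j) := by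
        rw [Finset.mul_sum, Finset.mul_sum]
    _ ≤ Fintype.card (Fin n → Fin (2 ^ L) × ZMod p) * (1 / 500) := by
        gcongr
        calc (l : ℝ) * ∑ j ∈ Finset.Ico j₂ (L + 1), (1 / 2 : ℝ) ^ j
            ≤ l * (2 * (1 / 2) ^ j₂) := by gcongr; exact sum_Ico_half_pow_le _ _
          _ ≤ (1 / 500) := by norm_num at h2 ⊢; linarith

theorem selectedLevel_le {L m a : ℕ} (hL : L = (m + 1) * (a + 1)) (x : Fin n → ZMod p)
    (ω : Fin n → Fin (2 ^ L) × ZMod p) : selectedLevel L m a x ω ≤ L := by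
  have h1 := (coarseLevel L m a x ω).is_le
  have h2 := (fineLevel L m x ω (coarseLevel L m a x ω)).is_lt
  have h3 := Nat.mul_le_mul_left (m + 1) h1
  have h4 : (m + 1) * (a + 1) = (m + 1) * a + (m + 1) := by ring
  unfold selectedLevel
  omega

/-- Too high is excluded because the selected bucket is nonzero, or is a default at the lowest
level. Too low is excluded by only two low buckets: the one at the ideal level `j₀` and the one at
the coarse level just below it. Hence no union bound over low levels is needed. -/
theorem selectedLevel_good_of_not {L m a : ℕ} (hL : L = (m + 1) * (a + 1))
    (x : Fin n → ZMod p) (hn : hammingNorm x < 2 ^ L)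
    (ω : Fin n → Fin (2 ^ L) × ZMod p) (hx : hammingNorm x ≠ 0)
    (hA : ¬ ∃ j ≤ L, 1000 * hammingNorm x < 2 ^ j ∧ bucket L j x ω ≠ 0)
    (hB : ∀ j₀, 1 ≤ j₀ → j₀ ≤ L → 1000 * 2 ^ j₀ ≤ hammingNorm x →
      hammingNorm x < 2000 * 2 ^ j₀ →
      bucket L ((m + 1) * ((j₀ - 1) / (m + 1)) + 1) x ω ≠ 0 ∧ bucket L j₀ x ω ≠ 0) :
    2 ^ selectedLevel L m a x ω ≤ 1000 * hammingNorm x ∧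
      hammingNorm x < 2000 * 2 ^ selectedLevel L m a x ω := by
  set l := hammingNorm x
  have hA' : ∀ j ≤ L, bucket L j x ω ≠ 0 → 2 ^ j ≤ 1000 * l := by
    intro j hj hb
    by_contra hcon
    exact hA ⟨j, hj, not_le.1 hcon, hb⟩
  have hjL := selectedLevel_le hL x ω
  unfold selectedLevel at hjL ⊢
  set h := coarseLevel L m a x ω with hh
  set r := fineLevel L m x ω h with hr
  constructor
  · rcases topNonzero_eq_zero_or fun r : Fin (m + 1) => bucket L ((m + 1) * h + 1 + r) x ω
      with h0 | h0
    · have hr0 : r = 0 := h0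
      rw [hr0]
      -- With fine part `0` the selected level is the coarse one. If that is the default too, the
      -- level is `1`, and `2 ≤ 1000 * l` because `l ≠ 0`.
      rcases topNonzero_eq_zero_or fun h : Fin (a + 1) => bucket L ((m + 1) * h + 1) x ω
        with h1 | h1
      · have hh0 : h = 0 := h1
        rw [hh0]
        simp only [Fin.val_zero, mul_zero, zero_add, add_zero, pow_one]
        omega
      · refine hA' _ (by simp only [Fin.val_zero]; omega) ?_
        rw [Fin.val_zero, add_zero]
        exact h1
    · exact hA' _ hjL h0
  · by_cases hl : l < 2000
    · have := Nat.one_le_two_pow (n := (m + 1) * h + 1 + r)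
      omega
    · set j₀ := Nat.log 2 (l / 1000) with hj₀
      have hdiv : l / 1000 ≠ 0 := by omega
      have hj1 : 1 ≤ j₀ := Nat.le_log_of_pow_le (by norm_num) (by omega)
      have h1 : 2 ^ j₀ ≤ l / 1000 := Nat.pow_log_le_self 2 hdiv
      have h2 : l / 1000 < 2 ^ (j₀ + 1) := Nat.lt_pow_succ_log_self (by norm_num) _
      rw [pow_succ] at h2
      have h3 : j₀ < L := by
        by_contra hcon
        have := Nat.pow_le_pow_right (n := 2) two_pos (not_lt.1 hcon)
        omega
      obtain ⟨hb1, hb2⟩ := hB j₀ hj1 h3.le (by omega) (by omega)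
      have hdm := Nat.div_add_mod (j₀ - 1) (m + 1)
      have hml := Nat.mod_lt (j₀ - 1) (Nat.succ_pos m)
      set h₀ := (j₀ - 1) / (m + 1)
      set r₀ := (j₀ - 1) % (m + 1)
      have hh₀ : h₀ < a + 1 := by
        rw [Nat.div_lt_iff_lt_mul (Nat.succ_pos m), mul_comm, ← hL]
        omega
      have hle : (⟨h₀, hh₀⟩ : Fin (a + 1)) ≤ h :=
        le_topNonzero (y := fun h : Fin (a + 1) => bucket L ((m + 1) * h + 1) x ω) hb1
      have hle' : h₀ ≤ h := hle
      have hkey : j₀ ≤ (m + 1) * h + 1 + r := by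
        -- If the coarse search stopped at the block of `j₀`, the fine search sees level `j₀`; if it
        -- stopped at a later block, that block already lies above `j₀`.
        rcases hle'.eq_or_lt with he | hlt
        · have hr₀ : (⟨r₀, hml⟩ : Fin (m + 1)) ≤ r := by
            refine le_topNonzero
              (y := fun r : Fin (m + 1) => bucket L ((m + 1) * h + 1 + r) x ω) ?_
            rw [← he]
            have : (m + 1) * h₀ + 1 + r₀ = j₀ := by omega
            simpa [this] using hb2
          have hr₀' : r₀ ≤ r := hr₀
          rw [← he]
          omega
        · have := Nat.mul_le_mul_left (m + 1) (Nat.succ_le_of_lt hlt)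
          rw [Nat.mul_succ] at this
          omega
      have h4 := Nat.pow_le_pow_right (n := 2) two_pos hkey
      omega

/-- At most three events of probability `1 / 500` each can spoil the level. -/
theorem card_bad_selectedLevel_le [Fact p.Prime] (hp : 1000 ≤ p) {L m a : ℕ}
    (hL : L = (m + 1) * (a + 1)) (x : Fin n → ZMod p) (hn : n < 2 ^ L) :
    ((Finset.univ.filter fun ω : Fin n → Fin (2 ^ L) × ZMod p =>
      ¬ (hammingNorm x ≠ 0 → 2 ^ selectedLevel L m a x ω ≤ 1000 * hammingNorm x ∧
        hammingNorm x < 2000 * 2 ^ selectedLevel L m a x ω)).card : ℝ) * 100 ≤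
      Fintype.card (Fin n → Fin (2 ^ L) × ZMod p) := by
  classical
  by_cases hx : hammingNorm x = 0
  · simp only [hx, ne_eq, not_true_eq_false, false_imp_iff, Finset.filter_false,
      Finset.card_empty, Nat.cast_zero, zero_mul]
    positivity
  have hl : hammingNorm x < 2 ^ L :=
    lt_of_le_of_lt (by simpa using hammingNorm_le_card_fintype (x := x)) hn
  set N : ℝ := (Fintype.card (Fin n → Fin (2 ^ L) × ZMod p) : ℝ) with hN
  have hN0 : 0 ≤ N := by positivity
  set S := Finset.univ.filter fun ω : Fin n → Fin (2 ^ L) × ZMod p =>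
      ¬ (hammingNorm x ≠ 0 → 2 ^ selectedLevel L m a x ω ≤ 1000 * hammingNorm x ∧
        hammingNorm x < 2000 * 2 ^ selectedLevel L m a x ω)
  have hcA := card_exists_bucket_ne_zero_le L x hx
  set A := Finset.univ.filter fun ω => ∃ j ≤ L, 1000 * hammingNorm x < 2 ^ j ∧
      bucket L j x ω ≠ 0
  by_cases hj : ∃ j₀, 1 ≤ j₀ ∧ j₀ ≤ L ∧ 1000 * 2 ^ j₀ ≤ hammingNorm x ∧
      hammingNorm x < 2000 * 2 ^ j₀
  · obtain ⟨j₀, hj1, hjL, hlo, hhi⟩ := hj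
    set j₁ := (m + 1) * ((j₀ - 1) / (m + 1)) + 1
    have hj₁ : j₁ ≤ j₀ := by
      have := Nat.mul_div_le (j₀ - 1) (m + 1)
      omega
    have hpow := Nat.pow_le_pow_right (n := 2) two_pos hj₁
    have hc1 := card_bucket_eq_zero_le hp (hj₁.trans hjL) x (by omega)
    have hc2 := card_bucket_eq_zero_le hp hjL x hlo
    have hsub : S ⊆ A ∪ ((Finset.univ.filter fun ω => bucket L j₁ x ω = 0) ∪
        Finset.univ.filter fun ω => bucket L j₀ x ω = 0) := by
      intro ω hω
      by_contra hcon
      simp only [A, Finset.mem_union, Finset.mem_filter, Finset.mem_univ, true_and, not_or] at hcon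
      refine (Finset.mem_filter.1 hω).2 fun _ =>
        selectedLevel_good_of_not hL x hl ω hx hcon.1 fun j hj hjL hlo' hhi' => ?_
      -- The window `1000 * 2 ^ j ≤ l < 2000 * 2 ^ j` is dyadic, so it contains `l` for only one
      -- `j`.
      have : j = j₀ := by
        rcases lt_trichotomy j j₀ with h | h | h
        · have := Nat.pow_le_pow_right (n := 2) two_pos (Nat.succ_le_of_lt h)
          rw [Nat.succ_eq_add_one, pow_succ] at this
          omega
        · exact h
        · have := Nat.pow_le_pow_right (n := 2) two_pos (Nat.succ_le_of_lt h)
          rw [Nat.succ_eq_add_one, pow_succ] at this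
          omega
      subst this
      exact hcon.2
    have hc : (S.card : ℝ) ≤ A.card +
        ((Finset.univ.filter fun ω => bucket L j₁ x ω = 0).card +
          (Finset.univ.filter fun ω => bucket L j₀ x ω = 0).card) := by
      exact_mod_cast (Finset.card_le_card hsub).trans ((Finset.card_union_le _ _).trans
        (Nat.add_le_add_left (Finset.card_union_le _ _) _))
    rw [← hN] at hcA hc1 hc2
    linarith
  · have hsub : S ⊆ A := by
      intro ω hω
      by_contra hcon
      simp only [A, Finset.mem_filter, Finset.mem_univ, true_and] at hcon
      exact (Finset.mem_filter.1 hω).2 fun _ =>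
        selectedLevel_good_of_not hL x hl ω hx hcon fun j h1 h2 h3 h4 =>
          absurd ⟨j, h1, h2, h3, h4⟩ hj
    have hc : (S.card : ℝ) ≤ A.card := by exact_mod_cast Finset.card_le_card hsub
    rw [← hN] at hcA
    linarith

end LevelSelection

/-! ### Random primes and reduction of the vector -/

section Primes

/-- The primes between `1000` and `2 ^ s`. -/
def largePrimes (s : ℕ) : Finset ℕ :=
  (Finset.range (2 ^ s + 1)).filter fun p => p.Prime ∧ 1000 ≤ p

theorem mem_largePrimes {s p : ℕ} : p ∈ largePrimes s ↔ p ≤ 2 ^ s ∧ p.Prime ∧ 1000 ≤ p := by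
  simp [largePrimes]

instance {s : ℕ} (p : largePrimes s) : Fact (p : ℕ).Prime := ⟨(mem_largePrimes.1 p.2).2.1⟩

theorem card_largePrimes_le (s : ℕ) : (largePrimes s).card ≤ 2 ^ s := by
  have h : largePrimes s ⊆ (Finset.range (2 ^ s + 1)).erase 0 := by
    intro p hp
    have := mem_largePrimes.1 hp
    simp only [Finset.mem_erase, Finset.mem_range]
    omega
  simpa using Finset.card_le_card h

/-- Chebyshev's lower bound gives about `2 ^ s / s` primes. Since `s ≤ 2 ^ (w + 10)` and `2 ^ s` is
the square of that power, at least `2 ^ (w + 10) - 2` primes exist, and discarding those below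
`1000` still leaves `2 ^ w`. -/
theorem two_pow_le_card_largePrimes (w : ℕ) : 2 ^ w ≤ (largePrimes (2 * w + 20)).card := by
  set s := 2 * w + 20 with hs
  have h1 : (Nat.primesLE (2 ^ s)).card ≤ (largePrimes s).card + 1000 := by
    have hsub : Nat.primesLE (2 ^ s) ⊆ largePrimes s ∪ Finset.range 1000 := by
      intro p hp
      rw [Nat.mem_primesLE] at hp
      rw [Finset.mem_union, mem_largePrimes, Finset.mem_range]
      rcases lt_or_ge p 1000 with h | h
      · exact Or.inr h
      · exact Or.inl ⟨hp.1, hp.2, h⟩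
    simpa using (Finset.card_le_card hsub).trans (Finset.card_union_le _ _)
  have h2 : (2 : ℝ) ^ s - (s + 1) ≤ (Nat.primesLE (2 ^ s)).card * s := by
    have h3 := Chebyshev.psi_ge (2 ^ s)
    have h4 := Chebyshev.psi_le_primeCounting_mul_log (2 ^ s)
    rw [← Nat.primesLE_card_eq_primeCounting] at h4
    have hlog2 : 0 < Real.log 2 := Real.log_pos one_lt_two
    have h5 : Real.log ((2 ^ s : ℕ) + 1) ≤ (s + 1) * Real.log 2 := by
      have : ((s : ℝ) + 1) * Real.log 2 = Real.log (2 ^ (s + 1)) := by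
        rw [Real.log_pow]; push_cast; ring
      rw [this]
      refine Real.log_le_log (by positivity) ?_
      have := one_le_pow₀ (n := s) (one_le_two (α := ℝ))
      rw [pow_succ (2 : ℝ) s]
      push_cast
      linarith
    have h6 : Real.log ((2 ^ s : ℕ) : ℝ) = s * Real.log 2 := by
      push_cast; rw [Real.log_pow]
    rw [h6] at h4
    push_cast at h3 h5
    have h7 : ((2 : ℝ) ^ s - (s + 1)) * Real.log 2 ≤
        ((Nat.primesLE (2 ^ s)).card * s) * Real.log 2 := by
      push_cast at h4
      linarith
    exact le_of_mul_le_mul_right h7 hlog2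
  have h3 : 2 ^ s ≤ ((Nat.primesLE (2 ^ s)).card + 2) * s := by
    have h4 : (2 : ℝ) ^ s ≤ ((Nat.primesLE (2 ^ s)).card + 2) * s := by
      have : (1 : ℝ) ≤ s := by exact_mod_cast (by omega : 1 ≤ s)
      linarith
    exact_mod_cast h4
  have h4 : s ≤ 2 ^ (w + 10) := by
    have := Nat.lt_two_pow_self (n := w)
    rw [pow_add]
    omega
  have h5 : 2 ^ s = 2 ^ (w + 10) * 2 ^ (w + 10) := by
    rw [← pow_add]; congr 1; omega
  have h6 : 2 ^ (w + 10) ≤ (Nat.primesLE (2 ^ s)).card + 2 := by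
    by_contra hcon
    have h7 := Nat.mul_lt_mul_of_lt_of_le (not_le.1 hcon) h4 (by omega)
    omega
  have h7 := Nat.one_le_two_pow (n := w)
  rw [pow_add] at h6
  omega

theorem two_pow_card_primeFactors_le {k : ℕ} (hk : k ≠ 0) : 2 ^ k.primeFactors.card ≤ k := by
  calc 2 ^ k.primeFactors.card = ∏ _p ∈ k.primeFactors, 2 := by simp
    _ ≤ ∏ p ∈ k.primeFactors, p :=
        Finset.prod_le_prod' fun p hp => (Nat.prime_of_mem_primeFactors hp).two_le
    _ ≤ k := Nat.le_of_dvd (Nat.pos_of_ne_zero hk) (Nat.prod_primeFactors_dvd k)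

/-- The vector of the residues modulo `p`. -/
def residues {n : ℕ} (p : ℕ) (x : Fin n → ℤ) : Fin n → ZMod p := fun i => (x i : ZMod p)

theorem hammingNorm_residues_le {n : ℕ} (p : ℕ) (x : Fin n → ℤ) :
    hammingNorm (residues p x) ≤ hammingNorm x :=
  Finset.card_le_card fun i hi => by
    refine Finset.mem_filter.2 ⟨Finset.mem_univ _, fun h => (Finset.mem_filter.1 hi).2 ?_⟩
    simp [residues, h]

/-- For most primes, most of the nonzero coordinates remain nonzero modulo that prime. -/
theorem card_bad_primes_le {n M : ℕ} (s : ℕ) (x : Fin n → ℤ) (hx : ∀ i, |x i| ≤ (M : ℤ)) (γ : ℝ) :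
    ((Finset.univ.filter fun p : largePrimes s =>
      (hammingNorm (residues p x) : ℝ) < (1 - γ) * hammingNorm x).card : ℝ) * γ ≤
      Nat.log 2 M := by
  classical
  set B := Finset.univ.filter fun p : largePrimes s =>
    (hammingNorm (residues p x) : ℝ) < (1 - γ) * hammingNorm x
  rcases Nat.eq_zero_or_pos (hammingNorm x) with h0 | h0
  · have : B = ∅ := by
      refine Finset.filter_eq_empty_iff.2 fun p _ => ?_
      rw [h0]
      simp
    simp [this]
  set T := Finset.univ.filter fun i => x i ≠ 0
  have hT : T.card = hammingNorm x := rfl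
  -- Double counting of the pairs of a bad prime and a nonzero entry that it divides: each entry has
  -- at most `log₂ M` prime divisors.
  have hcount : ∑ p ∈ B, (T.filter fun i => ((p : ℕ) : ℤ) ∣ x i).card ≤
      hammingNorm x * Nat.log 2 M := by
    change ∑ p ∈ B, (T.bipartiteAbove (fun (p : largePrimes s) i => ((p : ℕ) : ℤ) ∣ x i) p).card ≤ _
    rw [Finset.sum_card_bipartiteAbove_eq_sum_card_bipartiteBelow
      (fun (p : largePrimes s) i => ((p : ℕ) : ℤ) ∣ x i), ← hT, ← smul_eq_mul]
    refine Finset.sum_le_card_nsmul _ _ _ fun i hi => ?_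
    have hxi : x i ≠ 0 := (Finset.mem_filter.1 hi).2
    have hk : (x i).natAbs ≠ 0 := Int.natAbs_ne_zero.2 hxi
    have h1 : (B.bipartiteBelow (fun (p : largePrimes s) i => ((p : ℕ) : ℤ) ∣ x i) i).card ≤
        (x i).natAbs.primeFactors.card := by
      refine Finset.card_le_card_of_injOn (fun p : largePrimes s => (p : ℕ)) (fun p hp => ?_)
        (fun _ _ _ _ h => Subtype.ext h)
      have hp' : ((p : ℕ) : ℤ) ∣ x i := (Finset.mem_filter.1 hp).2
      exact Nat.mem_primeFactors.2 ⟨Fact.out, Int.natCast_dvd.1 hp', hk⟩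
    have h2 : (x i).natAbs ≤ M := by
      have := hx i
      rw [Int.abs_eq_natAbs] at this
      exact_mod_cast this
    exact h1.trans (Nat.le_log_of_pow_le one_lt_two ((two_pow_card_primeFactors_le hk).trans h2))
  have hB : ∀ p ∈ B, γ * hammingNorm x ≤ ((T.filter fun i => ((p : ℕ) : ℤ) ∣ x i).card : ℝ) := by
    intro p hp
    have h1 : (hammingNorm (residues p x) : ℝ) < (1 - γ) * hammingNorm x :=
      (Finset.mem_filter.1 hp).2
    have h2 : (T.filter fun i => ((p : ℕ) : ℤ) ∣ x i).card + hammingNorm (residues p x) =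
        hammingNorm x := by
      rw [← hT, ← Finset.card_filter_add_card_filter_not (s := T) (fun i => ((p : ℕ) : ℤ) ∣ x i)]
      congr 1
      refine congrArg Finset.card ?_
      ext i
      simp only [T, residues, Finset.mem_filter, Finset.mem_univ, true_and, ne_eq,
        ZMod.intCast_zmod_eq_zero_iff_dvd]
      constructor
      · intro h
        exact ⟨fun h0 => h (by rw [h0]; exact dvd_zero _), h⟩
      · exact fun h => h.2
    have h3 : ((T.filter fun i => ((p : ℕ) : ℤ) ∣ x i).card : ℝ) + hammingNorm (residues p x) =
        hammingNorm x := by exact_mod_cast h2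
    linarith
  have h1 : (B.card : ℝ) * (γ * hammingNorm x) ≤ hammingNorm x * Nat.log 2 M := by
    rw [← nsmul_eq_mul]
    refine (Finset.card_nsmul_le_sum _ _ _ hB).trans ?_
    exact_mod_cast hcount
  have h2 : (0 : ℝ) < hammingNorm x := by exact_mod_cast h0
  refine le_of_mul_le_mul_left ?_ h2
  linarith

end Primes

/-! ### Short lists of seeds that work for all vectors -/

section Seeds

variable {n p : ℕ}

/-- The level `j` is good for a vector with `l` nonzero coordinates. -/
def LevelGood (l j : ℕ) : Prop := l ≠ 0 → 2 ^ j ≤ 1000 * l ∧ l < 2000 * 2 ^ j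

/-- There are at most `2 ^ (s * n)` vectors modulo `p`, so the union bound needs only `O(s * n)`
seeds, and an index into them takes `O(log n + log s)` bits. The `+ 1` keeps the list nonempty when
`n = 0`. -/
theorem exists_levelSeeds [Fact p.Prime] (hp : 1000 ≤ p) {s L m a : ℕ} (hs : p ≤ 2 ^ s)
    (hL : L = (m + 1) * (a + 1)) (hn : n < 2 ^ L) :
    ∃ f : Fin (40 * (s * n + 1)) → Fin n → Fin (2 ^ L) × ZMod p, ∀ x : Fin n → ZMod p,
      {θ | ¬ LevelGood (hammingNorm x) (selectedLevel L m a x (f θ))}.ncard * 20 ≤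
        40 * (s * n + 1) := by
  classical
  obtain ⟨f, hf⟩ := exists_seeds
    (fun (x : Fin n → ZMod p) (ω : Fin n → Fin (2 ^ L) × ZMod p) =>
      ¬ LevelGood (hammingNorm x) (selectedLevel L m a x ω)) (s * n + 1)
    (by
      rw [Fintype.card_fun, ZMod.card, Fintype.card_fin, pow_succ, pow_mul]
      exact (Nat.pow_le_pow_left hs n).trans (Nat.le_mul_of_pos_right _ two_pos))
    (fun x => by convert card_bad_selectedLevel_le hp hL x hn)
  refine ⟨f, fun x => ?_⟩
  have := hf x
  rw [← Set.ncard_coe_finset] at this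
  simp only [Finset.coe_filter, Finset.mem_univ, true_and] at this
  omega

/-- The estimate for the number of nonzero coordinates from a prime, a level, and the contents of
the buckets of this level. -/
noncomputable def bucketEstimate {K : ℕ} (p A : ℕ) (ε : ℝ) (j : ℕ) (y : Fin K → ZMod p) : ℕ :=
  invZeroProb p j ((1 / 4) ^ A / (8 * A) * ε) (zeroFraction y)

/-- If the level fits, then the estimate is good. -/
def EstimateGood (A : ℕ) (ε : ℝ) (l j e : ℕ) : Prop :=
  1 ≤ j → (l ≠ 0 → l ≤ A * 2 ^ j ∧ 2 ^ j ≤ A * l) → (1 - ε / 2) * l ≤ e ∧ e ≤ l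

/-- The union bound also runs over the levels, so that the seeds work for whichever level an
independent search has selected. -/
theorem exists_estimateSeeds [Fact p.Prime] {s L A K : ℕ} {ε : ℝ} (hs : p ≤ 2 ^ s)
    (hε : 0 < ε) (hA : 0 < A) (hK0 : 0 < K)
    (hK : 100 ≤ K * ((1 / 4) ^ A / (8 * A) * ε) ^ 2) :
    ∃ f : Fin (40 * (s * n + L + 1)) → Fin K → Fin n → Fin (2 ^ L) × ZMod p,
      ∀ (x : Fin n → ZMod p) (j : ℕ), j ≤ L →
      {θ | ¬ EstimateGood A ε (hammingNorm x) j
        (bucketEstimate p A ε j fun b => bucket L j x (f θ b))}.ncard * 20 ≤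
        40 * (s * n + L + 1) := by
  classical
  obtain ⟨f, hf⟩ := exists_seeds
    (fun (x : (Fin n → ZMod p) × Fin (L + 1)) (ω : Fin K → Fin n → Fin (2 ^ L) × ZMod p) =>
      ¬ EstimateGood A ε (hammingNorm x.1) x.2
        (bucketEstimate p A ε x.2 fun b => bucket L x.2 x.1 (ω b))) (s * n + L + 1)
    (by
      rw [Fintype.card_prod, Fintype.card_fun, ZMod.card, Fintype.card_fin, Fintype.card_fin,
        add_assoc, pow_add, pow_mul]
      exact Nat.mul_le_mul (Nat.pow_le_pow_left hs n) (Nat.lt_two_pow_self).le)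
    (by
      rintro ⟨x, j⟩
      by_cases hj : 1 ≤ (j : ℕ) ∧ (hammingNorm x ≠ 0 →
          hammingNorm x ≤ A * 2 ^ (j : ℕ) ∧ 2 ^ (j : ℕ) ≤ A * hammingNorm x)
      · have := card_bad_estimate_le hε hA hj.1 (Nat.lt_succ_iff.1 j.2) hK0 hK x hj.2
        refine le_trans ?_ this
        gcongr with ω
        exact fun h _ _ => h
      · have h0 : (Finset.univ.filter fun ω : Fin K → Fin n → Fin (2 ^ L) × ZMod p =>
            ¬ EstimateGood A ε (hammingNorm x) j
              (bucketEstimate p A ε j fun b => bucket L j x (ω b))) = ∅ :=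
          Finset.filter_eq_empty_iff.2 fun ω _ h => h fun h1 h2 => absurd ⟨h1, h2⟩ hj
        simp only [h0, Finset.card_empty, Nat.cast_zero, zero_mul]
        positivity)
  refine ⟨f, fun x j hj => ?_⟩
  have := hf (x, ⟨j, Nat.lt_succ_of_le hj⟩)
  rw [← Set.ncard_coe_finset] at this
  simp only [Finset.coe_filter, Finset.mem_univ, true_and] at this
  omega

end Seeds

/-- Fubini for counting: a failure rate that holds for each fixed choice of the other parts of a
seed holds overall. It is used to randomize one part of the seed at a time. -/
theorem card_filter_le_of_equiv {Θ α β : Type*} [Fintype Θ] [Fintype α] [Fintype β]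
    (e : α × β ≃ Θ) (P : Θ → Prop) (κ : ℝ)
    (h : ∀ a, ({b | P (e (a, b))}.ncard : ℝ) ≤ κ * Fintype.card β) :
    ({θ | P θ}.ncard : ℝ) ≤ κ * Fintype.card Θ := by
  classical
  have h1 : ({θ | P θ}.ncard : ℝ) = ∑ a, ({b | P (e (a, b))}.ncard : ℝ) := by
    have h2 : ∀ {γ : Type _} [Fintype γ] (Q : γ → Prop),
        ({c | Q c}.ncard : ℝ) = ∑ c, if Q c then (1 : ℝ) else 0 := by
      intro γ _ Q
      rw [Finset.sum_boole, ← Set.ncard_coe_finset]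
      simp
    have h3 : ∀ a, ({b | P (e (a, b))}.ncard : ℝ) = ∑ b, if P (e (a, b)) then (1 : ℝ) else 0 := by
      intro a
      rw [Finset.sum_boole, ← Set.ncard_coe_finset]
      simp
    rw [h2, ← e.sum_comp, Fintype.sum_prod_type]
    simp only [h3]
  rw [h1, ← Fintype.card_congr e, Fintype.card_prod]
  calc ∑ a, ({b | P (e (a, b))}.ncard : ℝ) ≤ ∑ _a : α, κ * Fintype.card β :=
        Finset.sum_le_sum fun a _ => h a
    _ = _ := by
        rw [Finset.sum_const, Finset.card_univ, nsmul_eq_mul]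
        push_cast
        ring

/-! ### The combined estimate, its failure probability and its passes -/

section Sketch

/-- A seed: a prime and an index for the choice of the level, and a prime and an index for the final
estimate. -/
abbrev SketchSeed (s₁ k₁ s₂ k₂ : ℕ) : Type := largePrimes s₁ × Fin k₁ × largePrimes s₂ × Fin k₂

variable {n s₁ k₁ s₂ k₂ L K : ℕ}
  (F₁ : ∀ p : largePrimes s₁, Fin k₁ → Fin n → Fin (2 ^ L) × ZMod p)
  (F₂ : ∀ p : largePrimes s₂, Fin k₂ → Fin K → Fin n → Fin (2 ^ L) × ZMod p)

/-- The estimate for the number of nonzero coordinates of `x`. -/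
noncomputable def l0Estimate (m a A : ℕ) (ε : ℝ) (x : Fin n → ℤ) (θ : SketchSeed s₁ k₁ s₂ k₂) : ℕ :=
  bucketEstimate θ.2.2.1 A ε (selectedLevel L m a (residues θ.1 x) (F₁ θ.1 θ.2.1)) fun b =>
    bucket L (selectedLevel L m a (residues θ.1 x) (F₁ θ.1 θ.2.1)) (residues θ.2.2.1 x)
      (F₂ θ.2.2.1 θ.2.2.2 b)

/-- The level was found for the first residue vector but is used for the second. Both norms are
within a factor `2` of `l`, so the constant `2000` at most doubles, hence `A ≥ 4000`. The errors of
the second prime and of the buckets multiply to `(1 - ε / 2) ^ 2 ≥ 1 - ε`. -/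
theorem estimate_mem_of_good {l l₁ l₂ j e A : ℕ} {ε : ℝ} (hε0 : 0 < ε) (hε1 : ε ≤ 1)
    (hA : 4000 ≤ A) (h1l : l₁ ≤ l) (h2l : l₂ ≤ l) (hl1 : (1 - 1 / 2) * (l : ℝ) ≤ l₁)
    (hl2 : (1 - ε / 2) * (l : ℝ) ≤ l₂) (hj1 : 1 ≤ j) (hj : LevelGood l₁ j)
    (he : EstimateGood A ε l₂ j e) : (1 - ε) * (l : ℝ) ≤ e ∧ (e : ℝ) ≤ (1 + ε) * l := by
  have hl0 : (0 : ℝ) ≤ l := by positivity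
  have h1 : l ≤ 2 * l₁ := by
    have : (l : ℝ) ≤ 2 * l₁ := by linarith
    exact_mod_cast this
  have h2 : l ≤ 2 * l₂ := by
    have : (l : ℝ) ≤ 2 * l₂ := by nlinarith
    exact_mod_cast this
  obtain ⟨h3, h4⟩ := he hj1 fun h0 => by
    obtain ⟨h5, h6⟩ := hj (by omega)
    constructor
    · calc l₂ ≤ 4000 * 2 ^ j := by omega
        _ ≤ A * 2 ^ j := Nat.mul_le_mul_right _ hA
    · calc 2 ^ j ≤ 4000 * l₂ := by omega
        _ ≤ A * l₂ := Nat.mul_le_mul_right _ hA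
  have h5 : (e : ℝ) ≤ l := by exact_mod_cast h4.trans h2l
  constructor
  · calc (1 - ε) * (l : ℝ) ≤ (1 - ε / 2) * ((1 - ε / 2) * l) := by nlinarith [sq_nonneg ε]
      _ ≤ (1 - ε / 2) * l₂ := mul_le_mul_of_nonneg_left hl2 (by linarith)
      _ ≤ e := h3
  · nlinarith

theorem ncard_bad_l0Estimate_le {m a A M : ℕ} {ε : ℝ} (hε0 : 0 < ε) (hε1 : ε ≤ 1)
    (hA : 4000 ≤ A) (hL : L = (m + 1) * (a + 1))
    (hP₁ : 50 * (Nat.log 2 M : ℝ) ≤ (largePrimes s₁).card)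
    (hP₂ : 50 * (Nat.log 2 M : ℝ) ≤ (largePrimes s₂).card * ε)
    (hF₁ : ∀ (p : largePrimes s₁) (x : Fin n → ZMod p),
      {θ | ¬ LevelGood (hammingNorm x) (selectedLevel L m a x (F₁ p θ))}.ncard * 20 ≤ k₁)
    (hF₂ : ∀ (p : largePrimes s₂) (x : Fin n → ZMod p) (j : ℕ), j ≤ L →
      {θ | ¬ EstimateGood A ε (hammingNorm x) j
        (bucketEstimate p A ε j fun b => bucket L j x (F₂ p θ b))}.ncard * 20 ≤ k₂)
    (x : Fin n → ℤ) (hx : ∀ i, |x i| ≤ (M : ℤ)) :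
    ({θ | ¬ ((1 - ε) * (hammingNorm x : ℝ) ≤ l0Estimate F₁ F₂ m a A ε x θ ∧
      (l0Estimate F₁ F₂ m a A ε x θ : ℝ) ≤ (1 + ε) * hammingNorm x)}.ncard : ℝ) ≤
      (1 - 0.8) * Fintype.card (SketchSeed s₁ k₁ s₂ k₂) := by
  classical
  have hb₁ := card_bad_primes_le s₁ x hx (1 / 2)
  have hb₂ := card_bad_primes_le s₂ x hx (ε / 2)
  have hB₁ : ({θ : SketchSeed s₁ k₁ s₂ k₂ | (hammingNorm (residues θ.1 x) : ℝ) <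
      (1 - 1 / 2) * hammingNorm x}.ncard : ℝ) ≤
      1 / 25 * Fintype.card (SketchSeed s₁ k₁ s₂ k₂) := by
    let e : ((Fin k₁ × largePrimes s₂ × Fin k₂) × largePrimes s₁) ≃ SketchSeed s₁ k₁ s₂ k₂ :=
      { toFun := fun t => (t.2, t.1)
        invFun := fun t => (t.2, t.1)
        left_inv := fun _ => rfl
        right_inv := fun _ => rfl }
    refine card_filter_le_of_equiv e _ _ fun c => ?_
    rw [← Set.ncard_coe_finset] at hb₁
    simp only [Finset.coe_filter, Finset.mem_univ, true_and] at hb₁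
    simp only [e, Equiv.coe_fn_mk, Fintype.card_coe]
    linarith
  have hB₂ : ({θ : SketchSeed s₁ k₁ s₂ k₂ | (hammingNorm (residues θ.2.2.1 x) : ℝ) <
      (1 - ε / 2) * hammingNorm x}.ncard : ℝ) ≤
      1 / 25 * Fintype.card (SketchSeed s₁ k₁ s₂ k₂) := by
    let e : ((largePrimes s₁ × Fin k₁ × Fin k₂) × largePrimes s₂) ≃ SketchSeed s₁ k₁ s₂ k₂ :=
      { toFun := fun t => (t.1.1, t.1.2.1, t.2, t.1.2.2)
        invFun := fun t => ((t.1, t.2.1, t.2.2.2), t.2.2.1)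
        left_inv := fun _ => rfl
        right_inv := fun _ => rfl }
    refine card_filter_le_of_equiv e _ _ fun c => ?_
    rw [← Set.ncard_coe_finset] at hb₂
    simp only [Finset.coe_filter, Finset.mem_univ, true_and] at hb₂
    simp only [e, Equiv.coe_fn_mk, Fintype.card_coe]
    have h1 : ({p : largePrimes s₂ | (hammingNorm (residues p x) : ℝ) <
        (1 - ε / 2) * hammingNorm x}.ncard : ℝ) * ε ≤ (1 / 25 * (largePrimes s₂).card) * ε := by
      linarith
    exact le_of_mul_le_mul_right h1 hε0
  have hB₃ : ({θ : SketchSeed s₁ k₁ s₂ k₂ | ¬ LevelGood (hammingNorm (residues θ.1 x))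
      (selectedLevel L m a (residues θ.1 x) (F₁ θ.1 θ.2.1))}.ncard : ℝ) ≤
      1 / 20 * Fintype.card (SketchSeed s₁ k₁ s₂ k₂) := by
    let e : ((largePrimes s₁ × largePrimes s₂ × Fin k₂) × Fin k₁) ≃ SketchSeed s₁ k₁ s₂ k₂ :=
      { toFun := fun t => (t.1.1, t.2, t.1.2)
        invFun := fun t => ((t.1, t.2.2), t.2.1)
        left_inv := fun _ => rfl
        right_inv := fun _ => rfl }
    refine card_filter_le_of_equiv e _ _ fun c => ?_
    simp only [e, Equiv.coe_fn_mk, Fintype.card_fin]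
    have h1 : (({θ | ¬ LevelGood (hammingNorm (residues c.1 x))
        (selectedLevel L m a (residues c.1 x) (F₁ c.1 θ))}.ncard : ℕ) : ℝ) * 20 ≤ k₁ := by
      exact_mod_cast hF₁ c.1 (residues c.1 x)
    linarith
  have hB₄ : ({θ : SketchSeed s₁ k₁ s₂ k₂ | ¬ EstimateGood A ε (hammingNorm (residues θ.2.2.1 x))
      (selectedLevel L m a (residues θ.1 x) (F₁ θ.1 θ.2.1))
      (l0Estimate F₁ F₂ m a A ε x θ)}.ncard : ℝ) ≤
      1 / 20 * Fintype.card (SketchSeed s₁ k₁ s₂ k₂) := by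
    let e : ((largePrimes s₁ × Fin k₁ × largePrimes s₂) × Fin k₂) ≃ SketchSeed s₁ k₁ s₂ k₂ :=
      { toFun := fun t => (t.1.1, t.1.2.1, t.1.2.2, t.2)
        invFun := fun t => ((t.1, t.2.1, t.2.2.1), t.2.2.2)
        left_inv := fun _ => rfl
        right_inv := fun _ => rfl }
    refine card_filter_le_of_equiv e _ _ fun c => ?_
    simp only [e, Equiv.coe_fn_mk, Fintype.card_fin, l0Estimate]
    -- The level depends only on the frozen parts of the seed, so it is a fixed `j` here.
    have h1 := hF₂ c.2.2 (residues c.2.2 x) _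
      (selectedLevel_le hL (residues c.1 x) (F₁ c.1 c.2.1))
    have h2 : (({θ | ¬ EstimateGood A ε (hammingNorm (residues c.2.2 x))
        (selectedLevel L m a (residues c.1 x) (F₁ c.1 c.2.1))
        (bucketEstimate c.2.2 A ε (selectedLevel L m a (residues c.1 x) (F₁ c.1 c.2.1)) fun b =>
          bucket L (selectedLevel L m a (residues c.1 x) (F₁ c.1 c.2.1)) (residues c.2.2 x)
            (F₂ c.2.2 θ b))}.ncard : ℕ) : ℝ) * 20 ≤ k₂ := by
      exact_mod_cast h1
    linarith
  set B₁ := {θ : SketchSeed s₁ k₁ s₂ k₂ | (hammingNorm (residues θ.1 x) : ℝ) <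
      (1 - 1 / 2) * hammingNorm x}
  set B₂ := {θ : SketchSeed s₁ k₁ s₂ k₂ | (hammingNorm (residues θ.2.2.1 x) : ℝ) <
      (1 - ε / 2) * hammingNorm x}
  set B₃ := {θ : SketchSeed s₁ k₁ s₂ k₂ | ¬ LevelGood (hammingNorm (residues θ.1 x))
      (selectedLevel L m a (residues θ.1 x) (F₁ θ.1 θ.2.1))}
  set B₄ := {θ : SketchSeed s₁ k₁ s₂ k₂ | ¬ EstimateGood A ε (hammingNorm (residues θ.2.2.1 x))
      (selectedLevel L m a (residues θ.1 x) (F₁ θ.1 θ.2.1))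
      (l0Estimate F₁ F₂ m a A ε x θ)}
  have hsub : {θ | ¬ ((1 - ε) * (hammingNorm x : ℝ) ≤ l0Estimate F₁ F₂ m a A ε x θ ∧
      (l0Estimate F₁ F₂ m a A ε x θ : ℝ) ≤ (1 + ε) * hammingNorm x)} ⊆
      (B₁ ∪ B₂) ∪ (B₃ ∪ B₄) := by
    intro θ hθ
    by_contra hcon
    simp only [B₁, B₂, B₃, B₄, Set.mem_union, Set.mem_ofPred_eq, not_or, not_not, not_lt] at hcon
    obtain ⟨⟨h1, h2⟩, h3, h4⟩ := hcon
    exact hθ (estimate_mem_of_good hε0 hε1 hA (hammingNorm_residues_le _ x)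
      (hammingNorm_residues_le _ x) h1 h2 (by unfold selectedLevel; omega) h3 h4)
  have hcard : ({θ | ¬ ((1 - ε) * (hammingNorm x : ℝ) ≤ l0Estimate F₁ F₂ m a A ε x θ ∧
      (l0Estimate F₁ F₂ m a A ε x θ : ℝ) ≤ (1 + ε) * hammingNorm x)}.ncard : ℝ) ≤
      (B₁.ncard + B₂.ncard) + (B₃.ncard + B₄.ncard) := by
    exact_mod_cast (Set.ncard_le_ncard hsub (Set.toFinite _)).trans
      ((Set.ncard_union_le _ _).trans
        (Nat.add_le_add (Set.ncard_union_le _ _) (Set.ncard_union_le _ _)))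
  -- The four failure rates sum to `1/25 + 1/25 + 1/20 + 1/20 = 0.18`.
  have hpos : (0 : ℝ) ≤ Fintype.card (SketchSeed s₁ k₁ s₂ k₂) := by positivity
  norm_num only at hpos ⊢
  linarith

/-- The number of zero entries. -/
def zeroCount {K p : ℕ} (y : Fin K → ZMod p) : Fin (K + 1) :=
  ⟨(Finset.univ.filter fun b => y b = 0).card,
    Nat.lt_succ_of_le (by simpa using Finset.card_filter_le (Finset.univ : Finset (Fin K)) _)⟩

theorem sum_smul_sampledCoeff {p : ℕ} (j : ℕ) (x : Fin n → ℤ)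
    (ω : Fin n → Fin (2 ^ L) × ZMod p) :
    ∑ i, x i • sampledCoeff L j (ω i) = bucket L j (residues p x) ω := by
  simp [bucket, residues, zsmul_eq_mul]

/-- The type of the accumulators depends on the primes in the seed, so the states form a dependent
sum; each residue costs as many bits as its prime. -/
theorem card_sketch_le (h₁ h₂ : ℕ) {κ₁ κ₂ : ℕ} (H : Type) [Fintype H] (u : ℕ)
    (hH : Fintype.card H ≤ 2 ^ u) (hk₁ : k₁ ≤ 2 ^ κ₁) (hk₂ : k₂ ≤ 2 ^ κ₂)
    (Acc : SketchSeed s₁ k₁ s₂ k₂ → Type) [∀ θ, Fintype (Acc θ)]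
    (hAcc : ∀ θ, Fintype.card (Acc θ) ≤ (θ.1 : ℕ) ^ h₁ * (θ.2.2.1 : ℕ) ^ h₂) :
    Fintype.card (Σ θ, H × Acc θ) ≤
      2 ^ ((s₁ + (κ₁ + (s₂ + κ₂))) + (u + (s₁ * h₁ + s₂ * h₂))) := by
  rw [Fintype.card_sigma, pow_add 2 (s₁ + _)]
  calc ∑ θ, Fintype.card (H × Acc θ)
      ≤ ∑ _θ : SketchSeed s₁ k₁ s₂ k₂, 2 ^ (u + (s₁ * h₁ + s₂ * h₂)) := by
        refine Finset.sum_le_sum fun θ _ => ?_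
        rw [Fintype.card_prod, pow_add, pow_add, pow_mul, pow_mul]
        refine Nat.mul_le_mul hH ((hAcc θ).trans (Nat.mul_le_mul ?_ ?_))
        · exact Nat.pow_le_pow_left (mem_largePrimes.1 θ.1.2).1 _
        · exact Nat.pow_le_pow_left (mem_largePrimes.1 θ.2.2.1.2).1 _
    _ ≤ _ := by
        rw [Finset.sum_const, smul_eq_mul, Finset.card_univ]
        refine Nat.mul_le_mul_right _ ?_
        simp only [Fintype.card_prod, Fintype.card_coe, Fintype.card_fin, pow_add]
        exact Nat.mul_le_mul (card_largePrimes_le _) (Nat.mul_le_mul hk₁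
          (Nat.mul_le_mul (card_largePrimes_le _) hk₂))

/-- What remains between the passes: the two parts of the level, and the number of zero buckets. -/
abbrev SketchRegister (a m K : ℕ) : Type := Fin (a + 1) × Fin (m + 1) × Fin (K + 1)

theorem card_register_le (a m K : ℕ) : Fintype.card (SketchRegister a m K) ≤ 2 ^ (a + (m + K)) := by
  simp only [Fintype.card_prod, Fintype.card_fin, pow_add]
  exact Nat.mul_le_mul Nat.lt_two_pow_self (Nat.mul_le_mul Nat.lt_two_pow_self Nat.lt_two_pow_self)

variable (m a : ℕ)

/-- The estimate that is computed from the register in the end. -/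
noncomputable def registerEstimate (A : ℕ) (ε : ℝ) (θ : SketchSeed s₁ k₁ s₂ k₂)
    (h : SketchRegister a m K) : ℕ :=
  invZeroProb θ.2.2.1 ((m + 1) * h.1 + 1 + h.2.1) ((1 / 4) ^ A / (8 * A) * ε) ((h.2.2 : ℕ) / K)

/-- The coefficients of the sketch for three passes: in each pass, the buckets for the first
approximation to the level, for the second one, and for the final estimate. -/
def threePassCoeff (θ : SketchSeed s₁ k₁ s₂ k₂) (h : SketchRegister a m K) (i : Fin n) :
    (Fin (a + 1) → ZMod θ.1) × (Fin (m + 1) → ZMod θ.1) × (Fin K → ZMod θ.2.2.1) :=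
  (fun h' => sampledCoeff L ((m + 1) * h' + 1) (F₁ θ.1 θ.2.1 i),
    fun r => sampledCoeff L ((m + 1) * h.1 + 1 + r) (F₁ θ.1 θ.2.1 i),
    fun b => sampledCoeff L ((m + 1) * h.1 + 1 + h.2.1) (F₂ θ.2.2.1 θ.2.2.2 b i))

theorem sum_threePassCoeff (θ : SketchSeed s₁ k₁ s₂ k₂) (h : SketchRegister a m K)
    (x : Fin n → ℤ) : ∑ i, x i • threePassCoeff F₁ F₂ m a θ h i =
      (fun h' : Fin (a + 1) => bucket L ((m + 1) * h' + 1) (residues θ.1 x) (F₁ θ.1 θ.2.1),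
      fun r : Fin (m + 1) => bucket L ((m + 1) * h.1 + 1 + r) (residues θ.1 x) (F₁ θ.1 θ.2.1),
      fun b => bucket L ((m + 1) * h.1 + 1 + h.2.1) (residues θ.2.2.1 x)
        (F₂ θ.2.2.1 θ.2.2.2 b)) := by
  refine Prod.ext ?_ (Prod.ext ?_ ?_)
  · funext h'
    simp [threePassCoeff, Prod.fst_sum, Finset.sum_apply, ← sum_smul_sampledCoeff]
  · funext r
    simp [threePassCoeff, Prod.fst_sum, Prod.snd_sum, Finset.sum_apply, ← sum_smul_sampledCoeff]
  · funext b
    simp [threePassCoeff, Prod.snd_sum, Finset.sum_apply, ← sum_smul_sampledCoeff]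

/-- The estimate can be computed in three passes: the first one determines the level roughly, the
second one determines the level, and the third one fills the buckets of this level. -/
theorem exists_threePass_machine [Nonempty (SketchSeed s₁ k₁ s₂ k₂)] (A : ℕ) (ε : ℝ)
    {κ₁ κ₂ : ℕ} (hk₁ : k₁ ≤ 2 ^ κ₁) (hk₂ : k₂ ≤ 2 ^ κ₂) :
    ∃ T : StreamMachine n, T.bits = (s₁ + (κ₁ + (s₂ + κ₂))) +
        (a + (m + K) + (s₁ * ((a + 1) + (m + 1)) + s₂ * K)) ∧
      ∀ σ, T.outputDist 3 σ = (PMF.uniformOfFintype (SketchSeed s₁ k₁ s₂ k₂)).map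
        fun θ => (l0Estimate F₁ F₂ m a A ε (streamVector σ) θ : ℝ) := by
  obtain ⟨T, hT, hσ⟩ := exists_streamMachine_of_linearSketch _ (threePassCoeff F₁ F₂ m a)
    -- Every pass recomputes all three components. The coarse level is right from the first pass on,
    -- the fine level from the second, the count from the third; values based on premature levels
    -- are overwritten.
    (fun θ h y => (topNonzero y.1, topNonzero y.2.1, zeroCount y.2.2)) (0, 0, 0)
    (fun θ h => (registerEstimate m a A ε θ h : ℕ))
    _ (card_sketch_le ((a + 1) + (m + 1)) K _ _ (card_register_le a m K) hk₁ hk₂ _ fun θ => by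
      simp only [Fintype.card_prod, Fintype.card_fun, ZMod.card, Fintype.card_fin, pow_add,
        mul_assoc, le_refl]) 3
  refine ⟨T, hT, fun σ => ?_⟩
  rw [hσ]
  congr 1
  funext θ
  simp only [sum_threePassCoeff, Function.iterate_succ_apply', Function.iterate_zero, id_eq]
  rfl

/-- The coefficients of the sketch for two passes: as for three passes, but with buckets for the
final estimate for each possible second part of the level. -/
def twoPassCoeff (θ : SketchSeed s₁ k₁ s₂ k₂) (h : SketchRegister a m K) (i : Fin n) :
    (Fin (a + 1) → ZMod θ.1) × (Fin (m + 1) → ZMod θ.1) × (Fin (m + 1) → Fin K → ZMod θ.2.2.1) :=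
  (fun h' => sampledCoeff L ((m + 1) * h' + 1) (F₁ θ.1 θ.2.1 i),
    fun r => sampledCoeff L ((m + 1) * h.1 + 1 + r) (F₁ θ.1 θ.2.1 i),
    fun r b => sampledCoeff L ((m + 1) * h.1 + 1 + r) (F₂ θ.2.2.1 θ.2.2.2 b i))

theorem sum_twoPassCoeff (θ : SketchSeed s₁ k₁ s₂ k₂) (h : SketchRegister a m K)
    (x : Fin n → ℤ) : ∑ i, x i • twoPassCoeff F₁ F₂ m a θ h i =
      (fun h' : Fin (a + 1) => bucket L ((m + 1) * h' + 1) (residues θ.1 x) (F₁ θ.1 θ.2.1),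
      fun r : Fin (m + 1) => bucket L ((m + 1) * h.1 + 1 + r) (residues θ.1 x) (F₁ θ.1 θ.2.1),
      fun (r : Fin (m + 1)) b => bucket L ((m + 1) * h.1 + 1 + r) (residues θ.2.2.1 x)
        (F₂ θ.2.2.1 θ.2.2.2 b)) := by
  refine Prod.ext ?_ (Prod.ext ?_ ?_)
  · funext h'
    simp [twoPassCoeff, Prod.fst_sum, Finset.sum_apply, ← sum_smul_sampledCoeff]
  · funext r
    simp [twoPassCoeff, Prod.fst_sum, Prod.snd_sum, Finset.sum_apply, ← sum_smul_sampledCoeff]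
  · funext r b
    simp [twoPassCoeff, Prod.snd_sum, Finset.sum_apply, ← sum_smul_sampledCoeff]

/-- The estimate can be computed in two passes: the first one determines the level roughly, and the
second one determines the level and fills the buckets of all levels that are possible. -/
theorem exists_twoPass_machine [Nonempty (SketchSeed s₁ k₁ s₂ k₂)] (A : ℕ) (ε : ℝ)
    {κ₁ κ₂ : ℕ} (hk₁ : k₁ ≤ 2 ^ κ₁) (hk₂ : k₂ ≤ 2 ^ κ₂) :
    ∃ T : StreamMachine n, T.bits = (s₁ + (κ₁ + (s₂ + κ₂))) +
        (a + (m + K) + (s₁ * ((a + 1) + (m + 1)) + s₂ * (K * (m + 1)))) ∧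
      ∀ σ, T.outputDist 2 σ = (PMF.uniformOfFintype (SketchSeed s₁ k₁ s₂ k₂)).map
        fun θ => (l0Estimate F₁ F₂ m a A ε (streamVector σ) θ : ℝ) := by
  obtain ⟨T, hT, hσ⟩ := exists_streamMachine_of_linearSketch _ (twoPassCoeff F₁ F₂ m a)
    -- The fine level found at the end of the pass picks one of the `m + 1` groups of buckets filled
    -- during the same pass.
    (fun θ h y => (topNonzero y.1, topNonzero y.2.1, zeroCount (y.2.2 (topNonzero y.2.1))))
    (0, 0, 0) (fun θ h => (registerEstimate m a A ε θ h : ℕ))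
    _ (card_sketch_le ((a + 1) + (m + 1)) (K * (m + 1)) _ _ (card_register_le a m K) hk₁ hk₂ _
      fun θ => by
      simp only [Fintype.card_prod, Fintype.card_fun, ZMod.card, Fintype.card_fin, pow_add,
        mul_assoc, pow_mul, pow_one, le_refl, Nat.mul_add, mul_one]) 2
  refine ⟨T, hT, fun σ => ?_⟩
  rw [hσ]
  congr 1
  funext θ
  simp only [sum_twoPassCoeff, Function.iterate_succ_apply', Function.iterate_zero, id_eq]
  rfl

end Sketch

/-! ### Choice of parameters and space bounds -/

/-- With `r` passes, the machine outputs on each admissible stream, with probability at least `p`,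
a number within a factor `1 ± ε` of the number of nonzero coordinates. -/
def StreamMachine.EstimatesL0 {n : ℕ} (T : StreamMachine n) (r : ℕ) (p : ℝ) (M : ℕ) (ε : ℝ) :
    Prop :=
  ∀ σ : List (Update n), StreamBounded M σ →
    ENNReal.ofReal p ≤ (T.outputDist r σ).toOuterMeasure
      {Z : ℝ | (1 - ε) * (hammingNorm (streamVector σ) : ℝ) ≤ Z ∧
        Z ≤ (1 + ε) * (hammingNorm (streamVector σ) : ℝ)}

theorem exists_machines_of_parameters {n M w₁ w₂ K A : ℕ} {ε : ℝ} (hε0 : 0 < ε) (hε1 : ε ≤ 1)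
    (hA : 4000 ≤ A) (hw₁ : 50 * Nat.log 2 M ≤ 2 ^ w₁)
    (hw₂ : 50 * (Nat.log 2 M : ℝ) ≤ 2 ^ w₂ * ε) (hK0 : 0 < K)
    (hK : 100 ≤ K * ((1 / 4) ^ A / (8 * A) * ε) ^ 2) {s₁ s₂ : ℕ} (hs₁ : s₁ = 2 * w₁ + 20)
    (hs₂ : s₂ = 2 * w₂ + 20) :
    (∃ T : StreamMachine n, T.bits ≤ 16 + 4 * Nat.log 2 n + 5 * s₁ + 2 * s₂ + K + s₁ * (s₁ + 1) +
      s₂ * (K * (s₁ + 1)) ∧ T.EstimatesL0 2 0.8 M ε) ∧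
    (∃ T : StreamMachine n, T.bits ≤ 16 + 4 * Nat.log 2 n + 5 * s₁ + 2 * s₂ + K + s₁ * (s₁ + 1) +
      s₂ * K ∧ T.EstimatesL0 3 0.8 M ε) := by
  -- The coarse step is `m + 1 = s₁ + 1`, so the `a + 1` coarse buckets of `s₁` bits fit into `L ≤
  -- log₂ n + s₁ + 1` bits, while the fine search needs `s₁ * (s₁ + 1)`.
  set a := Nat.log 2 n / (s₁ + 1) with ha
  set L := (s₁ + 1) * (a + 1) with hL
  have hLlo : Nat.log 2 n < L := by
    have h1 := Nat.div_add_mod (Nat.log 2 n) (s₁ + 1)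
    have h2 := Nat.mod_lt (Nat.log 2 n) (Nat.add_one_pos s₁)
    rw [← ha] at h1
    rw [hL, Nat.mul_add, mul_one]
    omega
  have hLhi : L ≤ Nat.log 2 n + s₁ + 1 := by
    have h1 := Nat.mul_div_le (Nat.log 2 n) (s₁ + 1)
    rw [← ha] at h1
    rw [hL, Nat.mul_add, mul_one]
    omega
  have haL : a ≤ Nat.log 2 n := Nat.div_le_self _ _
  have hn1 : n < 2 ^ (Nat.log 2 n + 1) := Nat.lt_pow_succ_log_self one_lt_two n
  have hnL : n < 2 ^ L := hn1.trans_le (Nat.pow_le_pow_right two_pos hLlo)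
  have hP₁ : 2 ^ w₁ ≤ (largePrimes s₁).card := hs₁ ▸ two_pow_le_card_largePrimes w₁
  have hP₂ : 2 ^ w₂ ≤ (largePrimes s₂).card := hs₂ ▸ two_pow_le_card_largePrimes w₂
  have hseed₁ : ∀ p : largePrimes s₁, ∃ f : Fin (40 * (s₁ * n + 1)) → Fin n → Fin (2 ^ L) × ZMod p,
      ∀ x : Fin n → ZMod p,
      {θ | ¬ LevelGood (hammingNorm x) (selectedLevel L s₁ a x (f θ))}.ncard * 20 ≤
        40 * (s₁ * n + 1) := fun p =>
    exists_levelSeeds (mem_largePrimes.1 p.2).2.2 (mem_largePrimes.1 p.2).1 hL hnL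
  have hseed₂ : ∀ p : largePrimes s₂,
      ∃ f : Fin (40 * (s₂ * n + L + 1)) → Fin K → Fin n → Fin (2 ^ L) × ZMod p,
      ∀ (x : Fin n → ZMod p) (j : ℕ), j ≤ L →
      {θ | ¬ EstimateGood A ε (hammingNorm x) j
        (bucketEstimate p A ε j fun b => bucket L j x (f θ b))}.ncard * 20 ≤
        40 * (s₂ * n + L + 1) := fun p =>
    exists_estimateSeeds (mem_largePrimes.1 p.2).1 hε0 (by omega) hK0 hK
  choose F₁ hF₁ using hseed₁
  choose F₂ hF₂ using hseed₂
  have hk₁ : 40 * (s₁ * n + 1) ≤ 2 ^ (6 + s₁ + (Nat.log 2 n + 1)) := by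
    calc 40 * (s₁ * n + 1) ≤ 64 * (s₁ + 1) * (n + 1) := by nlinarith
      _ ≤ 2 ^ 6 * 2 ^ s₁ * 2 ^ (Nat.log 2 n + 1) := by
          gcongr
          · norm_num
          · exact Nat.lt_two_pow_self
          · exact hn1
      _ = _ := by rw [← pow_add, ← pow_add]
  have hk₂ : 40 * (s₂ * n + L + 1) ≤ 2 ^ (6 + (s₂ + s₁ + 1) + (Nat.log 2 n + 1)) := by
    have hlogn : Nat.log 2 n ≤ n := Nat.log_le_self 2 n
    have hLn : L ≤ n + s₁ + 1 := by omega
    calc 40 * (s₂ * n + L + 1) ≤ 64 * (s₂ + s₁ + 1 + 1) * (n + 1) := by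
          have h1 : s₂ * n + L + 1 ≤ (s₂ + s₁ + 1 + 1) * (n + 1) := by
            have h2 : (s₂ + s₁ + 1 + 1) * (n + 1) =
                s₂ * n + s₁ * n + 2 * n + s₂ + s₁ + 2 := by ring
            omega
          rw [mul_assoc]
          exact Nat.mul_le_mul (by norm_num) h1
      _ ≤ 2 ^ 6 * 2 ^ (s₂ + s₁ + 1) * 2 ^ (Nat.log 2 n + 1) := by
          gcongr
          · norm_num
          · exact Nat.lt_two_pow_self
          · exact hn1
      _ = _ := by rw [← pow_add, ← pow_add]
  have : Nonempty (SketchSeed s₁ (40 * (s₁ * n + 1)) s₂ (40 * (s₂ * n + L + 1))) := by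
    have h1 : (largePrimes s₁).Nonempty :=
      Finset.card_pos.1 (lt_of_lt_of_le (by positivity) hP₁)
    have h2 : (largePrimes s₂).Nonempty :=
      Finset.card_pos.1 (lt_of_lt_of_le (by positivity) hP₂)
    exact ⟨⟨_, h1.choose_spec⟩, ⟨0, by omega⟩, ⟨_, h2.choose_spec⟩, ⟨0, by omega⟩⟩
  have hP₁' : 50 * (Nat.log 2 M : ℝ) ≤ (largePrimes s₁).card := by exact_mod_cast hw₁.trans hP₁
  have hP₂' : 50 * (Nat.log 2 M : ℝ) ≤ (largePrimes s₂).card * ε := by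
    refine hw₂.trans (mul_le_mul_of_nonneg_right ?_ hε0.le)
    exact_mod_cast hP₂
  have hgood : ∀ (T : StreamMachine n) (r : ℕ),
      (∀ σ, T.outputDist r σ = (PMF.uniformOfFintype (SketchSeed s₁ (40 * (s₁ * n + 1)) s₂
        (40 * (s₂ * n + L + 1)))).map
        fun θ => (l0Estimate F₁ F₂ s₁ a A ε (streamVector σ) θ : ℝ)) →
      T.EstimatesL0 r 0.8 M ε := by
    intro T r hT σ hσ
    rw [hT]
    have hbad := ncard_bad_l0Estimate_le F₁ F₂ hε0 hε1 hA hL hP₁' hP₂' hF₁ hF₂ (streamVector σ)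
      (hσ σ List.prefix_rfl)
    set B := {θ | ¬ ((1 - ε) * (hammingNorm (streamVector σ) : ℝ) ≤
        l0Estimate F₁ F₂ s₁ a A ε (streamVector σ) θ ∧
      (l0Estimate F₁ F₂ s₁ a A ε (streamVector σ) θ : ℝ) ≤
        (1 + ε) * hammingNorm (streamVector σ))}
    refine ofReal_le_toOuterMeasure_map_uniform _ _ (Set.toFinite B).toFinset
      (fun θ hθ => ?_) _ ?_
    · simp only [B, Set.Finite.mem_toFinset, Set.mem_ofPred_eq, not_not] at hθ
      exact hθ
    · rw [← Set.ncard_eq_toFinset_card]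
      exact hbad
  have hsa : s₁ * (a + 1) ≤ L := Nat.mul_le_mul_right _ (Nat.le_succ _)
  obtain ⟨T₂, hT₂, hσ₂⟩ := exists_twoPass_machine F₁ F₂ s₁ a A ε hk₁ hk₂
  obtain ⟨T₃, hT₃, hσ₃⟩ := exists_threePass_machine F₁ F₂ s₁ a A ε hk₁ hk₂
  rw [Nat.mul_add s₁ (a + 1)] at hT₂ hT₃
  exact ⟨⟨T₂, by omega, hgood T₂ 2 hσ₂⟩, ⟨T₃, by omega, hgood T₃ 3 hσ₃⟩⟩

/-- This holds since `3 > e`. It gives a positive lower bound for `log log M`, against which all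
additive constants are absorbed. -/
theorem log_log_three_pos : 0 < Real.log (Real.log 3) := by
  refine Real.log_pos ?_
  rw [Real.lt_log_iff_exp_lt (by norm_num)]
  exact Real.exp_one_lt_d9.trans (by norm_num)

theorem log_log_three_le {M : ℕ} (hM : 3 ≤ M) :
    Real.log (Real.log 3) ≤ Real.log (Real.log M) := by
  have h3 : (0 : ℝ) < Real.log 3 := Real.log_pos (by norm_num)
  refine Real.log_le_log h3 (Real.log_le_log (by norm_num) ?_)
  exact_mod_cast hM

theorem half_lt_log_two : (1 / 2 : ℝ) < Real.log 2 :=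
  lt_trans (by norm_num) Real.log_two_gt_d9

theorem natLog_two_le (M : ℕ) : (Nat.log 2 M : ℝ) ≤ 2 * Real.log M := by
  rcases Nat.eq_zero_or_pos M with rfl | hM
  · simp
  have h1 : (2 : ℝ) ^ Nat.log 2 M ≤ M := by exact_mod_cast Nat.pow_log_le_self 2 hM.ne'
  have h2 := Real.log_le_log (by positivity) h1
  rw [Real.log_pow] at h2
  have h3 : (0 : ℝ) ≤ Nat.log 2 M := by positivity
  nlinarith [half_lt_log_two]

theorem clog_two_le {y : ℕ} (hy : 1 ≤ y) : (Nat.clog 2 y : ℝ) ≤ 2 * Real.log y + 1 := by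
  rcases hy.eq_or_lt with rfl | hy
  · simp
  have h0 : 0 < Nat.clog 2 y := Nat.clog_pos one_lt_two hy
  have h1 : (2 : ℝ) ^ (Nat.clog 2 y).pred ≤ y := by
    exact_mod_cast (Nat.pow_pred_clog_lt_self one_lt_two hy).le
  have h2 := Real.log_le_log (by positivity) h1
  rw [Real.log_pow] at h2
  have h3 : (Nat.clog 2 y : ℝ) = (Nat.clog 2 y).pred + 1 := by
    exact_mod_cast (Nat.succ_pred_eq_of_pos h0).symm
  have h4 : (0 : ℝ) ≤ (Nat.clog 2 y).pred := by positivity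
  nlinarith [half_lt_log_two]

theorem exists_machines : ∃ D : ℝ, 0 < D ∧ ∀ (n M : ℕ) (ε : ℝ), 3 ≤ M → 0 < ε → ε < 1 / 2 →
    ∃ s₁ s₂ K : ℕ, (s₁ : ℝ) ≤ D * Real.log (Real.log M) ∧
      (s₂ : ℝ) ≤ D * (Real.log (1 / ε) + Real.log (Real.log M)) ∧ (K : ℝ) ≤ D * (ε ^ 2)⁻¹ ∧
      (∃ T : StreamMachine n, T.bits ≤ 16 + 4 * Nat.log 2 n + 5 * s₁ + 2 * s₂ + K + s₁ * (s₁ + 1) +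
        s₂ * (K * (s₁ + 1)) ∧ T.EstimatesL0 2 0.8 M ε) ∧
      (∃ T : StreamMachine n, T.bits ≤ 16 + 4 * Nat.log 2 n + 5 * s₁ + 2 * s₂ + K + s₁ * (s₁ + 1) +
        s₂ * K ∧ T.EstimatesL0 3 0.8 M ε) := by
  -- Only `4000 ≤ A` is retained, so the tiny constant `(1 / 4) ^ A` is never evaluated.
  obtain ⟨A, hA⟩ : ∃ A : ℕ, 4000 ≤ A := ⟨4000, le_rfl⟩
  have hA0 : (0 : ℝ) < A := by exact_mod_cast (by omega : 0 < A)
  set c : ℝ := (1 / 4) ^ A / (8 * A) with hc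
  have hc0 : 0 < c := by positivity
  set u₀ := Real.log (Real.log 3)
  have hu₀ : 0 < u₀ := log_log_three_pos
  -- The bounds `w₁ ≤ 199 + 2 * u` and `e ≤ 3 + 2 * v` give `s₁ ≤ 418 + 4 * u` and `s₂ ≤ 424 + 4 *
  -- (v + u)`; the last summand is for `K`.
  refine ⟨(418 / u₀ + 4) + 6 / u₀ + (100 / c ^ 2 + 1), by positivity, fun n M ε hM hε0 hε => ?_⟩
  set u := Real.log (Real.log M) with hu
  set v := Real.log (1 / ε) with hv
  have hu₀u : u₀ ≤ u := log_log_three_le hM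
  have hu0 : 0 < u := hu₀.trans_le hu₀u
  have h1u : 1 ≤ u / u₀ := (one_le_div hu₀).2 hu₀u
  have hv0 : 0 ≤ v := Real.log_nonneg (by rw [le_div_iff₀ hε0]; linarith)
  have hlogM : 0 < Real.log M := Real.log_pos (by exact_mod_cast (by omega : 1 < M))
  set w₁ := Nat.clog 2 (50 * Nat.log 2 M)
  set e := Nat.clog 2 ⌈1 / ε⌉₊
  have hM1 : 1 ≤ Nat.log 2 M := Nat.le_log_of_pow_le one_lt_two (by omega)
  have hpow₁ : 50 * Nat.log 2 M ≤ 2 ^ w₁ := Nat.le_pow_clog one_lt_two _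
  have hw₁ : (w₁ : ℝ) ≤ 199 + 2 * u := by
    have h1 := clog_two_le (y := 50 * Nat.log 2 M) (by omega)
    have h2 : ((50 * Nat.log 2 M : ℕ) : ℝ) ≤ 100 * Real.log M := by
      push_cast; linarith [natLog_two_le M]
    have h3 : (0 : ℝ) < ((50 * Nat.log 2 M : ℕ) : ℝ) := by exact_mod_cast (by omega)
    have h4 := Real.log_le_log h3 h2
    rw [Real.log_mul (by norm_num) hlogM.ne'] at h4
    have h5 := Real.log_le_sub_one_of_pos (show (0 : ℝ) < 100 by norm_num)
    linarith
  have hceil : 1 / ε ≤ ⌈1 / ε⌉₊ := Nat.le_ceil _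
  have hpowe : (1 / ε : ℝ) ≤ 2 ^ e := by
    refine hceil.trans ?_
    exact_mod_cast Nat.le_pow_clog one_lt_two _
  have he : (e : ℝ) ≤ 3 + 2 * v := by
    have hpos : 0 < 1 / ε := by positivity
    have h0 : 1 ≤ ⌈1 / ε⌉₊ := Nat.ceil_pos.2 hpos
    have h1 := clog_two_le h0
    have h2 : (⌈1 / ε⌉₊ : ℝ) ≤ 2 * (1 / ε) := by
      have h3 := (Nat.ceil_lt_add_one hpos.le).le
      have h4 : 1 ≤ 1 / ε := by rw [le_div_iff₀ hε0]; linarith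
      linarith
    have h3 : (0 : ℝ) < (⌈1 / ε⌉₊ : ℝ) := by exact_mod_cast h0
    have h4 := Real.log_le_log h3 h2
    rw [Real.log_mul (by norm_num) hpos.ne'] at h4
    have h5 := Real.log_le_sub_one_of_pos (show (0 : ℝ) < 2 by norm_num)
    linarith
  have hcε : 0 < c * ε := by positivity
  have hKpos : 0 < 100 / (c * ε) ^ 2 := by positivity
  have hpow₂ : 50 * (Nat.log 2 M : ℝ) ≤ 2 ^ (w₁ + e) * ε := by
    have h1 : 50 * (Nat.log 2 M : ℝ) ≤ 2 ^ w₁ := by exact_mod_cast hpow₁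
    have h2 : 1 ≤ 2 ^ e * ε := by rwa [div_le_iff₀ hε0] at hpowe
    rw [pow_add, mul_assoc]
    calc 50 * (Nat.log 2 M : ℝ) ≤ 2 ^ w₁ * 1 := by linarith
      _ ≤ 2 ^ w₁ * (2 ^ e * ε) := by gcongr
  have hK : 100 ≤ (⌈100 / (c * ε) ^ 2⌉₊ : ℝ) * (c * ε) ^ 2 := by
    have := Nat.le_ceil (100 / (c * ε) ^ 2)
    rwa [div_le_iff₀ (by positivity)] at this
  refine ⟨2 * w₁ + 20, 2 * (w₁ + e) + 20, ⌈100 / (c * ε) ^ 2⌉₊, ?_, ?_, ?_,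
    exists_machines_of_parameters hε0 (by linarith) hA hpow₁ hpow₂ (Nat.ceil_pos.2 hKpos) hK rfl
    rfl⟩
  · push_cast
    have h2 : (418 : ℝ) * 1 ≤ 418 * (u / u₀) := by gcongr
    have h4 : 0 < 6 / u₀ + (100 / c ^ 2 + 1) := by positivity
    have h5 : ((418 / u₀ + 4) + 6 / u₀ + (100 / c ^ 2 + 1)) * u =
      418 * (u / u₀) + 4 * u + (6 / u₀ + (100 / c ^ 2 + 1)) * u := by ring
    rw [h5]
    have h6 := mul_pos h4 hu0
    linarith
  · push_cast
    have h2 : (424 : ℝ) * 1 ≤ 424 * (u / u₀) := by gcongr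
    have h4 : 0 < 100 / c ^ 2 + 1 := by positivity
    have h5 : ((418 / u₀ + 4) + 6 / u₀ + (100 / c ^ 2 + 1)) * (v + u) =
      424 * (u / u₀) + 424 / u₀ * v + 4 * (v + u) + (100 / c ^ 2 + 1) * (v + u) := by ring
    rw [h5]
    have h6 := mul_pos h4 (by linarith : 0 < v + u)
    have h7 : 0 ≤ 424 / u₀ * v := by positivity
    linarith
  · have h1 := (Nat.ceil_lt_add_one hKpos.le).le
    have h2 : 1 ≤ (ε ^ 2)⁻¹ := by
      rw [one_le_inv₀ (by positivity)]
      nlinarith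
    have h3 : 100 / (c * ε) ^ 2 = 100 / c ^ 2 * (ε ^ 2)⁻¹ := by
      field_simp
    have h4 : 0 < (418 / u₀ + 4) + 6 / u₀ := by positivity
    have h5 := mul_pos h4 (by positivity : 0 < (ε ^ 2)⁻¹)
    linarith

theorem StreamBounded.mono {n M M' : ℕ} (h : M ≤ M') {σ : List (Update n)}
    (hσ : StreamBounded M σ) : StreamBounded M' σ :=
  fun τ hτ i => (hσ τ hτ i).trans (by exact_mod_cast h)

/-- Machines for `3 ≤ M` and `ε < 1 / 2` suffice for an algorithm. -/
theorem exists_algorithm {r : ℕ} {p : ℝ} (Q : (n M : ℕ) → ℝ → ℕ → Prop)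
    (h : ∀ (n M : ℕ) (ε : ℝ), 3 ≤ M → 0 < ε → ε < 1 / 2 →
      ∃ T : StreamMachine n, Q n M ε T.bits ∧ T.EstimatesL0 r p M ε) :
    ∃ A : StreamAlgorithm, A.EstimatesL0 r p (1 / 2) ∧
      ∀ (n M : ℕ) (ε : ℝ), 3 ≤ M → 0 < ε → ε < 1 / 2 → Q n M ε (A n M ε).bits := by
  classical
  have h' : ∀ (n M : ℕ) (ε : ℝ), ∃ T : StreamMachine n, 0 < ε → ε < 1 / 2 →
      (3 ≤ M → Q n M ε T.bits) ∧ T.EstimatesL0 r p M ε := by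
    intro n M ε
    by_cases hε : 0 < ε ∧ ε < 1 / 2
    · obtain ⟨T, hT, hT'⟩ := h n (max M 3) ε (le_max_right _ _) hε.1 hε.2
      refine ⟨T, fun _ _ => ⟨fun hM => ?_, fun σ hσ => hT' σ (hσ.mono (le_max_left _ _))⟩⟩
      rwa [max_eq_left hM] at hT
    · obtain ⟨T, -⟩ := h n 3 (1 / 4) le_rfl (by norm_num) (by norm_num)
      exact ⟨T, fun h1 h2 => absurd ⟨h1, h2⟩ hε⟩
  choose A hA using h'
  exact ⟨A, fun n M ε h1 h2 => (hA n M ε h1 h2).2, fun n M ε hM h1 h2 => (hA n M ε h1 h2).1 hM⟩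

section Bounds

variable {D u v E l : ℝ} {n s₁ s₂ K : ℕ}

theorem common_bits_le (hD : 0 < D) {u₀ : ℝ} (hu₀ : 0 < u₀) (hu : u₀ ≤ u) (hv : 0 ≤ v) (hE : 1 ≤ E)
    (hs₁ : (s₁ : ℝ) ≤ D * u) (hs₂ : (s₂ : ℝ) ≤ D * (v + u)) (hK : (K : ℝ) ≤ D * E) :
    (16 + 4 * Nat.log 2 n + 5 * s₁ + 2 * s₂ + K : ℝ) ≤
      8 * Real.log n + (16 / u₀ + 7 * D + D / u₀) * (E * (v + u)) := by
  have h1 := natLog_two_le n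
  have h2 : 1 ≤ u / u₀ := (one_le_div hu₀).2 hu
  have hu0 : 0 < u := hu₀.trans_le hu
  have h3 : u ≤ E * (v + u) := by nlinarith
  have h4 : v + u ≤ E * (v + u) := by nlinarith
  have h5 : E ≤ E * (v + u) / u₀ := by
    rw [le_div_iff₀ hu₀]
    have : u₀ ≤ v + u := by linarith
    gcongr
  have h6 : 1 ≤ E * (v + u) / u₀ := hE.trans h5
  have h7 : (s₁ : ℝ) ≤ D * (E * (v + u)) := hs₁.trans (by gcongr)
  have h8 : (s₂ : ℝ) ≤ D * (E * (v + u)) := hs₂.trans (by gcongr)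
  have h9 : (K : ℝ) ≤ D * (E * (v + u) / u₀) := hK.trans (by gcongr)
  have h10 : (16 / u₀ + 7 * D + D / u₀) * (E * (v + u)) = 16 * (E * (v + u) / u₀) +
    7 * (D * (E * (v + u))) + D * (E * (v + u) / u₀) := by ring
  rw [h10]
  linarith

end Bounds

theorem one_le_inv_sq {ε : ℝ} (h0 : 0 < ε) (h1 : ε < 1 / 2) : 1 ≤ (ε ^ 2)⁻¹ := by
  rw [one_le_inv₀ (by positivity)]
  nlinarith

theorem log_one_div_nonneg {ε : ℝ} (h0 : 0 < ε) (h1 : ε < 1 / 2) : 0 ≤ Real.log (1 / ε) :=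
  Real.log_nonneg (by rw [le_div_iff₀ h0]; linarith)

theorem solvableWithinTwoPassBound_two : SolvableWithinTwoPassBound 2 := by
  obtain ⟨D, hD, h⟩ := exists_machines
  have hu₀ := log_log_three_pos
  set u₀ := Real.log (Real.log 3)
  set G : ℝ := (16 / u₀ + 7 * D + D / u₀) / u₀ + D * (D + 1 / u₀) + D * D * (D + 1 / u₀)
  have hG : 0 < G := by positivity
  obtain ⟨A, hA, hbits⟩ := exists_algorithm (r := 2) (p := 0.8)
    (fun n M ε b => (b : ℝ) ≤ (8 + G) * twoPassBound n M ε) (by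
      intro n M ε hM hε0 hε
      obtain ⟨s₁, s₂, K, hs₁, hs₂, hK, ⟨T, hT, hT'⟩, -⟩ := h n M ε hM hε0 hε
      refine ⟨T, ?_, hT'⟩
      have hu := log_log_three_le hM
      have hE := one_le_inv_sq hε0 hε
      have hv := log_one_div_nonneg hε0 hε
      unfold twoPassBound
      have hl : 0 ≤ Real.log n := Real.log_natCast_nonneg n
      have hcom := common_bits_le (n := n) hD hu₀ hu hv hE hs₁ hs₂ hK
      set u := Real.log (Real.log M)
      set v := Real.log (1 / ε)
      set E := (ε ^ 2)⁻¹
      have hu0 : 0 < u := hu₀.trans_le hu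
      have h1 : 1 ≤ u / u₀ := (one_le_div hu₀).2 hu
      have hs₁' : (s₁ : ℝ) + 1 ≤ (D + 1 / u₀) * u := by
        have : (D + 1 / u₀) * u = D * u + u / u₀ := by ring
        linarith
      have hX : 0 < v + u := by linarith
      have hb : (T.bits : ℝ) ≤ (16 + 4 * Nat.log 2 n + 5 * s₁ + 2 * s₂ + K : ℝ) +
          s₁ * (s₁ + 1) + s₂ * (K * (s₁ + 1)) := by exact_mod_cast hT
      have h2 : (s₁ : ℝ) * (s₁ + 1) ≤ (D * (D + 1 / u₀)) * (E * u * (v + u)) := by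
        calc (s₁ : ℝ) * (s₁ + 1) ≤ (D * u) * ((D + 1 / u₀) * u) := by gcongr
          -- Padded with `1 ≤ E` and `0 ≤ v` to match the target factor by factor.
          _ = (D * (D + 1 / u₀)) * (1 * u * (0 + u)) := by ring
          _ ≤ _ := by gcongr
      have h3 : (s₂ : ℝ) * (K * (s₁ + 1)) ≤ (D * D * (D + 1 / u₀)) * (E * u * (v + u)) := by
        calc (s₂ : ℝ) * (K * (s₁ + 1)) ≤ (D * (v + u)) * ((D * E) * ((D + 1 / u₀) * u)) := by
              gcongr
          _ = _ := by ring
      have h4 : (16 / u₀ + 7 * D + D / u₀) * (E * (v + u)) ≤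
          ((16 / u₀ + 7 * D + D / u₀) / u₀) * (E * u * (v + u)) := by
        calc (16 / u₀ + 7 * D + D / u₀) * (E * (v + u))
            ≤ (16 / u₀ + 7 * D + D / u₀) * (E * (v + u)) * (u / u₀) :=
              le_mul_of_one_le_right (by positivity) h1
          _ = _ := by ring
      have h5 : 0 ≤ E * u * (v + u) := by positivity
      have h6 : (8 + G) * (Real.log n + E * u * (v + u)) = 8 * Real.log n +
          G * (E * u * (v + u)) + (G * Real.log n + 8 * (E * u * (v + u))) := by ring
      rw [h6]
      have h7 : 0 ≤ G * Real.log n + 8 * (E * u * (v + u)) := by positivity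
      have h8 : G * (E * u * (v + u)) = ((16 / u₀ + 7 * D + D / u₀) / u₀) * (E * u * (v + u)) +
        (D * (D + 1 / u₀)) * (E * u * (v + u)) +
        (D * D * (D + 1 / u₀)) * (E * u * (v + u)) := by simp only [G]; ring
      linarith)
  exact ⟨1 / 2, by norm_num, A, hA, 8 + G, hbits⟩

theorem exists_threePass_algorithm : ∃ ε₀ : ℝ, 0 < ε₀ ∧ ∃ A : StreamAlgorithm,
    A.EstimatesL0 3 0.75 ε₀ ∧ ∀ c : ℝ, ∃ C : ℝ, ∀ (n M : ℕ) (ε : ℝ), 3 ≤ M →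
      (Real.log (Real.log M)) ^ 2 ≤ c * Real.log n → 0 < ε → ε < ε₀ →
        ((A n M ε).bits : ℝ) ≤ C * threePassBound n M ε := by
  obtain ⟨D, hD, h⟩ := exists_machines
  have hu₀ := log_log_three_pos
  set u₀ := Real.log (Real.log 3)
  set G : ℝ := (16 / u₀ + 7 * D + D / u₀) + D * D
  have hG : 0 < G := by positivity
  obtain ⟨A, hA, hbits⟩ := exists_algorithm (r := 3) (p := 0.8)
    (fun n M ε b => (b : ℝ) ≤ 8 * Real.log n + G * ((ε ^ 2)⁻¹ * (Real.log (1 / ε) +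
      Real.log (Real.log M))) + D * (D + 1 / u₀) * (Real.log (Real.log M)) ^ 2) (by
      intro n M ε hM hε0 hε
      obtain ⟨s₁, s₂, K, hs₁, hs₂, hK, -, ⟨T, hT, hT'⟩⟩ := h n M ε hM hε0 hε
      refine ⟨T, ?_, hT'⟩
      have hu := log_log_three_le hM
      have hE := one_le_inv_sq hε0 hε
      have hv := log_one_div_nonneg hε0 hε
      have hcom := common_bits_le (n := n) hD hu₀ hu hv hE hs₁ hs₂ hK
      set u := Real.log (Real.log M)
      set v := Real.log (1 / ε)
      set E := (ε ^ 2)⁻¹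
      have hu0 : 0 < u := hu₀.trans_le hu
      have h1 : 1 ≤ u / u₀ := (one_le_div hu₀).2 hu
      have hs₁' : (s₁ : ℝ) + 1 ≤ (D + 1 / u₀) * u := by
        have : (D + 1 / u₀) * u = D * u + u / u₀ := by ring
        linarith
      have hb : (T.bits : ℝ) ≤ (16 + 4 * Nat.log 2 n + 5 * s₁ + 2 * s₂ + K : ℝ) +
          s₁ * (s₁ + 1) + s₂ * K := by exact_mod_cast hT
      have h2 : (s₁ : ℝ) * (s₁ + 1) ≤ D * (D + 1 / u₀) * u ^ 2 := by
        calc (s₁ : ℝ) * (s₁ + 1) ≤ (D * u) * ((D + 1 / u₀) * u) := by gcongr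
          _ = _ := by ring
      have h3 : (s₂ : ℝ) * K ≤ D * D * (E * (v + u)) := by
        calc (s₂ : ℝ) * K ≤ (D * (v + u)) * (D * E) := by gcongr
          _ = _ := by ring
      have h8 : G * (E * (v + u)) = (16 / u₀ + 7 * D + D / u₀) * (E * (v + u)) +
        D * D * (E * (v + u)) := by simp only [G]; ring
      linarith)
  refine ⟨1 / 2, by norm_num, A, fun n M ε h1 h2 σ hσ => le_trans
    (ENNReal.ofReal_le_ofReal (by norm_num)) (hA n M ε h1 h2 σ hσ), fun c => ?_⟩
  -- The algorithm does not depend on `c`; only the fine-search term `(log log M) ^ 2` uses `c`, to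
  -- be absorbed into `log n`.
  refine ⟨8 + G + D * (D + 1 / u₀) * |c|, fun n M ε hM hc hε0 hε => (hbits n M ε hM hε0 hε).trans ?_⟩
  have hu := log_log_three_le hM
  have hE := one_le_inv_sq hε0 hε
  have hv := log_one_div_nonneg hε0 hε
  have hl : 0 ≤ Real.log n := Real.log_natCast_nonneg n
  unfold threePassBound
  set u := Real.log (Real.log M)
  set v := Real.log (1 / ε)
  set E := (ε ^ 2)⁻¹
  have hu0 : 0 < u := hu₀.trans_le hu
  have hX : 0 ≤ E * (v + u) := mul_nonneg (by linarith) (by linarith)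
  have h1 : D * (D + 1 / u₀) * u ^ 2 ≤ D * (D + 1 / u₀) * (|c| * Real.log n) := by
    have h2 : u ^ 2 ≤ |c| * Real.log n := hc.trans (by gcongr; exact le_abs_self c)
    gcongr
  have h3 : 0 ≤ D * (D + 1 / u₀) * |c| * (E * (v + u)) := by positivity
  have h4 : 0 ≤ G * Real.log n := by positivity
  nlinarith

/-! ### Lower bound for augmented indexing -/

section AugmentedIndexing

variable {J k : ℕ}

/-- The pattern of errors of guesses, each of which depends on the entries with larger first index
only, determines the guessed vector. -/
theorem xor_guess_injective (g : Fin J × Fin k → (Fin J × Fin k → Bool) → Bool)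
    (hg : ∀ q x y, (∀ q', q.1 < q'.1 → x q' = y q') → g q x = g q y) :
    Function.Injective fun (x : Fin J × Fin k → Bool) q => xor (x q) (g q x) := by
  intro x y h
  have key : ∀ d : ℕ, ∀ q : Fin J × Fin k, J - q.1 ≤ d → x q = y q := by
    intro d
    induction d with
    | zero => intro q hq; have := q.1.2; omega
    | succ d ih =>
      intro q hq
      have h1 : g q x = g q y := hg q x y fun q' hq' => ih q' (by
        have h2 : (q.1 : ℕ) < q'.1 := hq'
        omega)
      have h2 := congrFun h q
      simp only [h1] at h2
      simpa using h2
  funext q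
  exact key J q (Nat.sub_le _ _)

/-- The map from a vector to its error pattern is a bijection, so for a uniformly random vector the
errors are distributed like independent fair coins. -/
theorem sum_pow_errors (g : Fin J × Fin k → (Fin J × Fin k → Bool) → Bool)
    (hg : ∀ q x y, (∀ q', q.1 < q'.1 → x q' = y q') → g q x = g q y) (w : ℝ) :
    ∑ x : Fin J × Fin k → Bool, w ^ (Finset.univ.filter fun q => x q ≠ g q x).card =
      (1 + w) ^ (J * k) := by
  have hbij : Function.Bijective fun (x : Fin J × Fin k → Bool) q => xor (x q) (g q x) :=
    (xor_guess_injective g hg).bijective_of_finite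
  have h1 : ∀ x : Fin J × Fin k → Bool, w ^ (Finset.univ.filter fun q => x q ≠ g q x).card =
      ∏ q, if xor (x q) (g q x) then w else 1 := by
    intro x
    rw [Finset.prod_ite]
    simp
  simp only [h1]
  rw [hbij.sum_comp (fun e : Fin J × Fin k → Bool => ∏ q, if e q then w else 1)]
  have h2 := Finset.prod_univ_sum (fun _ : Fin J × Fin k => (Finset.univ : Finset Bool))
    (fun _ b => if b then w else 1)
  rw [Fintype.piFinset_univ] at h2
  rw [← h2]
  simp [add_comm]

/-- If each vector can be recovered, up to two fifths of the entries, from one of `2 ^ b` states by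
guesses that use the entries with larger first index, then `b` is linear in the length. -/
theorem le_bits_of_guesses {S : Type*} [Fintype S] {b : ℕ} (hS : Fintype.card S ≤ 2 ^ b)
    (g : S → Fin J × Fin k → (Fin J × Fin k → Bool) → Bool)
    (hg : ∀ s q x y, (∀ q', q.1 < q'.1 → x q' = y q') → g s q x = g s q y)
    (h : ∀ x, ∃ s, (Finset.univ.filter fun q => x q ≠ g s q x).card * 5 ≤ 2 * (J * k)) :
    J * k ≤ 100 * b := by
  -- Give each error the weight `0.92 ^ 5`: a vector with at most two fifths of errors weighs at
  -- least `0.92 ^ (2 * (J * k))`. It remains that `2 * 0.92 ^ 2` exceeds `1 + 0.92 ^ 5` by a factor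
  -- of at least `1.02`, and `1.02 ^ 100 ≥ 2`.
  have h1 : ((2 : ℝ) * 0.92 ^ 2) ^ (J * k) ≤ 2 ^ b * (1 + 0.92 ^ 5) ^ (J * k) := by
    calc ((2 : ℝ) * 0.92 ^ 2) ^ (J * k)
        = ∑ _x : Fin J × Fin k → Bool, (0.92 ^ 2 : ℝ) ^ (J * k) := by
          rw [mul_pow, Finset.sum_const, Finset.card_univ, nsmul_eq_mul]
          simp
      _ ≤ ∑ x : Fin J × Fin k → Bool, ∑ s,
            (0.92 ^ 5 : ℝ) ^ (Finset.univ.filter fun q => x q ≠ g s q x).card := by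
          refine Finset.sum_le_sum fun x _ => ?_
          obtain ⟨s, hs⟩ := h x
          refine le_trans ?_ (Finset.single_le_sum (f := fun s =>
            (0.92 ^ 5 : ℝ) ^ (Finset.univ.filter fun q => x q ≠ g s q x).card)
            (fun _ _ => by positivity) (Finset.mem_univ s))
          rw [← pow_mul, ← pow_mul, mul_comm 5]
          exact pow_le_pow_of_le_one (by norm_num) (by norm_num) hs
      _ = ∑ _s : S, (1 + 0.92 ^ 5 : ℝ) ^ (J * k) := by
          rw [Finset.sum_comm]
          exact Finset.sum_congr rfl fun s _ => sum_pow_errors (g s) (hg s) _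
      _ ≤ 2 ^ b * (1 + 0.92 ^ 5) ^ (J * k) := by
          rw [Finset.sum_const, Finset.card_univ, nsmul_eq_mul]
          gcongr
          exact_mod_cast hS
  have h2 : (1.02 : ℝ) ^ (J * k) ≤ 2 ^ b := by
    have h3 : (0 : ℝ) < (1 + 0.92 ^ 5) ^ (J * k) := by positivity
    refine le_of_mul_le_mul_right (le_trans ?_ h1) h3
    rw [← mul_pow]
    exact pow_le_pow_left₀ (by norm_num) (by norm_num) _
  have h3 : (2 : ℝ) ≤ 1.02 ^ 100 := by norm_num
  have h4 : (1.02 : ℝ) ^ (J * k) ≤ 1.02 ^ (100 * b) := by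
    rw [pow_mul (1.02 : ℝ) 100 b]
    exact h2.trans (pow_le_pow_left₀ (by norm_num) h3 _)
  exact (pow_le_pow_iff_right₀ (by norm_num)).1 h4

end AugmentedIndexing

/-! ### One-pass machines as one-way protocols -/

namespace PMF

theorem toOuterMeasure_add_compl {α : Type*} (p : PMF α) (s : Set α) :
    p.toOuterMeasure s + p.toOuterMeasure sᶜ = 1 := by
  have h : ∑' x, (s.indicator p x + sᶜ.indicator p x) = ∑' x, p x :=
    tsum_congr fun x => by by_cases hx : x ∈ s <;> simp [hx]
  rw [toOuterMeasure_apply, toOuterMeasure_apply]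
  exact ENNReal.tsum_add.symm.trans (h.trans p.tsum_coe)

theorem toOuterMeasure_le_one {α : Type*} (p : PMF α) (s : Set α) : p.toOuterMeasure s ≤ 1 := by
  rw [← p.toOuterMeasure_add_compl s]
  exact le_self_add

theorem toReal_toOuterMeasure_bind {α β : Type*} [Fintype α] (p : PMF α) (f : α → PMF β)
    (s : Set β) : ((p.bind f).toOuterMeasure s).toReal =
      ∑ a, (p a).toReal * ((f a).toOuterMeasure s).toReal := by
  rw [toOuterMeasure_bind_apply, tsum_fintype, ENNReal.toReal_sum]
  · simp only [ENNReal.toReal_mul]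
  · exact fun a _ => ENNReal.mul_ne_top (p.apply_ne_top a)
      (ne_top_of_le_ne_top ENNReal.one_ne_top ((f a).toOuterMeasure_le_one s))

theorem sum_toReal {α : Type*} [Fintype α] (p : PMF α) : ∑ a, (p a).toReal = 1 := by
  have h := p.tsum_coe
  rw [tsum_fintype] at h
  rw [← ENNReal.toReal_sum fun a _ => p.apply_ne_top a, h, ENNReal.toReal_one]

end PMF

namespace StreamMachine

variable {n : ℕ} (T : StreamMachine n)

theorem readFrom_append (σ τ : List (Update n)) (s : Fin T.bits → Bool) :
    T.readFrom (σ ++ τ) s = (T.readFrom σ s).bind (T.readFrom τ) := by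
  induction σ generalizing s with
  | nil => simp [readFrom]
  | cons u σ ih =>
    rw [List.cons_append, readFrom, readFrom, PMF.bind_bind]
    congr 1
    funext s
    exact ih s

/-- The distribution of the output if the pass ends after reading `τ` from the memory `s`. -/
noncomputable def finish (τ : List (Update n)) (s : Fin T.bits → Bool) : PMF ℝ :=
  ((T.readFrom τ s).bind T.endPass).map T.output

theorem outputDist_one_append (σ τ : List (Update n)) :
    T.outputDist 1 (σ ++ τ) = (T.init.bind (T.readFrom σ)).bind (T.finish τ) := by
  rw [outputDist, afterPasses, afterPasses, PMF.map_bind, PMF.bind_bind]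
  congr 1
  funext s
  rw [readFrom_append, PMF.bind_bind, PMF.map_bind]
  rfl

/-- One-pass machines yield one-way protocols for augmented indexing: if for all `x` and `q` the
output on `σ x ++ τ q x`, where `τ q x` depends only on the entries of `x` with larger first
index, separates the two cases for `x q`, then many bits are used. -/
theorem le_bits_of_separates {J k : ℕ} (σ : (Fin J × Fin k → Bool) → List (Update n))
    (τ : Fin J × Fin k → (Fin J × Fin k → Bool) → List (Update n))
    (hτ : ∀ q x y, (∀ q', q.1 < q'.1 → x q' = y q') → τ q x = τ q y) (t : Fin J × Fin k → ℝ)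
    (h : ∀ x q, ENNReal.ofReal 0.8 ≤ (T.outputDist 1 (σ x ++ τ q x)).toOuterMeasure
      (if x q then {Z | Z ≤ t q} else {Z | Z ≤ t q}ᶜ)) : J * k ≤ 100 * T.bits := by
  classical
  let pr : Fin J × Fin k → (Fin J × Fin k → Bool) → (Fin T.bits → Bool) → ℝ := fun q x s =>
    ((T.finish (τ q x) s).toOuterMeasure {Z | Z ≤ t q}).toReal
  -- The guess is the more likely answer given the memory `s`, so coins flipped afterwards do not
  -- matter. A wrong guess means success with probability at most `1 / 2` from `s`; success `0.8`
  -- overall thus forces error at most `2 / 5` in the mean.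
  let g : (Fin T.bits → Bool) → Fin J × Fin k → (Fin J × Fin k → Bool) → Bool := fun s q x =>
    decide (1 / 2 < pr q x s)
  refine le_bits_of_guesses (S := Fin T.bits → Bool) (by simp) g
    (fun s q x y hxy => by simp only [g, pr, hτ q x y hxy]) fun x => ?_
  set p := T.init.bind (T.readFrom (σ x))
  have hcorrect : ∀ q s, ((T.finish (τ q x) s).toOuterMeasure
      (if x q then {Z | Z ≤ t q} else {Z | Z ≤ t q}ᶜ)).toReal ≤
      1 - 1 / 2 * if x q ≠ g s q x then 1 else 0 := by
    intro q s
    have h1 : pr q x s + ((T.finish (τ q x) s).toOuterMeasure {Z | Z ≤ t q}ᶜ).toReal = 1 := by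
      simp only [pr]
      rw [← ENNReal.toReal_add, PMF.toOuterMeasure_add_compl, ENNReal.toReal_one]
      · exact ne_top_of_le_ne_top ENNReal.one_ne_top (PMF.toOuterMeasure_le_one _ _)
      · exact ne_top_of_le_ne_top ENNReal.one_ne_top (PMF.toOuterMeasure_le_one _ _)
    have h2 : 0 ≤ pr q x s := ENNReal.toReal_nonneg
    have h3 : 0 ≤ ((T.finish (τ q x) s).toOuterMeasure {Z | Z ≤ t q}ᶜ).toReal :=
      ENNReal.toReal_nonneg
    have h4 : ((T.finish (τ q x) s).toOuterMeasure {Z | Z ≤ t q}).toReal = pr q x s := rfl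
    by_cases hg : 1 / 2 < pr q x s
    · have hgt : g s q x = true := decide_eq_true hg
      cases hx : x q
      · simp only [hgt, Bool.false_eq_true, if_false, ne_eq, not_false_eq_true, if_true]
        linarith
      · simp only [hgt, if_true, ne_eq, not_true_eq_false, if_false, h4]
        linarith
    · have hgf : g s q x = false := decide_eq_false hg
      cases hx : x q
      · simp only [hgf, Bool.false_eq_true, if_false, ne_eq, not_true_eq_false]
        linarith
      · simp only [hgf, if_true, ne_eq, Bool.true_eq_false, not_false_eq_true, h4]
        linarith
  have herr : ∀ q, ∑ s, (p s).toReal * (if x q ≠ g s q x then (1 : ℝ) else 0) ≤ 2 / 5 := by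
    intro q
    have h1 := h x q
    rw [outputDist_one_append, ENNReal.ofReal_le_iff_le_toReal
      (ne_top_of_le_ne_top ENNReal.one_ne_top (PMF.toOuterMeasure_le_one _ _)),
      PMF.toReal_toOuterMeasure_bind] at h1
    have h2 : ∑ s, (p s).toReal * ((T.finish (τ q x) s).toOuterMeasure
        (if x q then {Z | Z ≤ t q} else {Z | Z ≤ t q}ᶜ)).toReal ≤
        ∑ s, (p s).toReal * (1 - 1 / 2 * if x q ≠ g s q x then 1 else 0) :=
      Finset.sum_le_sum fun s _ => mul_le_mul_of_nonneg_left (hcorrect q s) ENNReal.toReal_nonneg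
    have h3 : ∑ s, (p s).toReal * (1 - 1 / 2 * if x q ≠ g s q x then (1 : ℝ) else 0) =
        1 - 1 / 2 * ∑ s, (p s).toReal * (if x q ≠ g s q x then (1 : ℝ) else 0) := by
      simp only [mul_sub, mul_one, Finset.sum_sub_distrib, p.sum_toReal]
      rw [Finset.mul_sum]
      exact congrArg (1 - ·) (Finset.sum_congr rfl fun s _ => by ring)
    rw [h3] at h2
    norm_num only at h1
    have h4 := h1.trans h2
    linarith
  -- Averaging over the memory: the expected number of errors is at most `2 / 5 * (J * k)`, so some
  -- state attains this.
  by_contra! hcon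
  have h1 : ∑ s, (p s).toReal * (2 / 5 * (J * k) : ℝ) < ∑ s, (p s).toReal *
      ((Finset.univ.filter fun q => x q ≠ g s q x).card : ℝ) := by
    have hlt : ∀ s, (2 / 5 * (J * k) : ℝ) <
        ((Finset.univ.filter fun q => x q ≠ g s q x).card : ℝ) := by
      intro s
      have : (2 * (J * k) : ℝ) < ((Finset.univ.filter fun q => x q ≠ g s q x).card : ℝ) * 5 := by
        exact_mod_cast hcon s
      linarith
    obtain ⟨s₀, hs₀⟩ := p.support_nonempty
    refine Finset.sum_lt_sum (fun s _ => mul_le_mul_of_nonneg_left (hlt s).le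
      ENNReal.toReal_nonneg) ⟨s₀, Finset.mem_univ _, mul_lt_mul_of_pos_left (hlt s₀) ?_⟩
    exact ENNReal.toReal_pos ((p.mem_support_iff s₀).1 hs₀) (p.apply_ne_top s₀)
  rw [← Finset.sum_mul, p.sum_toReal, one_mul] at h1
  have h2 : ∑ s, (p s).toReal * ((Finset.univ.filter fun q => x q ≠ g s q x).card : ℝ) ≤
      2 / 5 * (J * k) := by
    calc ∑ s, (p s).toReal * ((Finset.univ.filter fun q => x q ≠ g s q x).card : ℝ)
        = ∑ q, ∑ s, (p s).toReal * (if x q ≠ g s q x then (1 : ℝ) else 0) := by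
          rw [Finset.sum_comm]
          refine Finset.sum_congr rfl fun s _ => ?_
          rw [← Finset.mul_sum, Finset.sum_boole]
      _ ≤ ∑ _q : Fin J × Fin k, (2 / 5 : ℝ) := Finset.sum_le_sum fun q _ => herr q
      _ = 2 / 5 * (J * k) := by
          rw [Finset.sum_const, Finset.card_univ, nsmul_eq_mul]
          simp only [Fintype.card_prod, Fintype.card_fin]
          push_cast
          ring
  linarith

end StreamMachine

/-! ### Hard streams with blocks of geometric sizes -/

section HardStreams

variable {n : ℕ}

/-- The stream that adds `δ` to the coordinates in `F`. -/
noncomputable def addOn (F : Finset (Fin n)) (δ : ℤ) : List (Update n) :=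
  F.toList.map fun i => (i, δ)

theorem streamVector_append (σ τ : List (Update n)) (i : Fin n) :
    streamVector (σ ++ τ) i = streamVector σ i + streamVector τ i := by
  simp [streamVector]

theorem sum_map_toList_ite (F : Finset (Fin n)) (δ : ℤ) (i : Fin n) :
    (F.toList.map fun j => if j = i then δ else 0).sum = if i ∈ F then δ else 0 := by
  rw [Finset.sum_map_toList]
  simp

theorem streamVector_addOn (F : Finset (Fin n)) (δ : ℤ) (i : Fin n) :
    streamVector (addOn F δ) i = if i ∈ F then δ else 0 := by
  rw [← sum_map_toList_ite]
  simp [streamVector, addOn, Function.comp_def]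

/-- The sum of the absolute values of all updates of a coordinate. -/
def totalChange (σ : List (Update n)) (i : Fin n) : ℤ :=
  (σ.map fun u => if u.1 = i then |u.2| else 0).sum

theorem totalChange_append (σ τ : List (Update n)) (i : Fin n) :
    totalChange (σ ++ τ) i = totalChange σ i + totalChange τ i := by
  simp [totalChange]

theorem totalChange_addOn_le (F : Finset (Fin n)) (δ : ℤ) (i : Fin n) :
    totalChange (addOn F δ) i ≤ |δ| := by
  have h : totalChange (addOn F δ) i = if i ∈ F then |δ| else 0 := by
    rw [← sum_map_toList_ite]
    simp [totalChange, addOn, Function.comp_def]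
  rw [h]
  split_ifs
  · exact le_rfl
  · exact abs_nonneg δ

theorem totalChange_nonneg (σ : List (Update n)) (i : Fin n) : 0 ≤ totalChange σ i := by
  refine List.sum_nonneg fun z hz => ?_
  obtain ⟨u, -, rfl⟩ := List.mem_map.1 hz
  split_ifs
  · exact abs_nonneg _
  · exact le_rfl

theorem abs_streamVector_le (σ : List (Update n)) (i : Fin n) :
    |streamVector σ i| ≤ totalChange σ i := by
  induction σ with
  | nil => simp [streamVector, totalChange]
  | cons u σ ih =>
    have h : totalChange (u :: σ) i = (if u.1 = i then |u.2| else 0) + totalChange σ i := by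
      simp [totalChange]
    rw [streamVector_cons, h]
    refine (abs_add_le _ _).trans (add_le_add ?_ ih)
    split_ifs <;> simp

theorem streamBounded_of_totalChange_le {M : ℕ} {σ : List (Update n)}
    (h : ∀ i, totalChange σ i ≤ M) : StreamBounded M σ := by
  rintro τ ⟨ρ, rfl⟩ i
  have h1 := h i
  rw [totalChange_append] at h1
  have h2 := abs_streamVector_le τ i
  have h3 := totalChange_nonneg ρ i
  linarith

theorem streamBounded_addOn (F G H : Finset (Fin n)) :
    StreamBounded 3 (addOn F 1 ++ (addOn G (-1) ++ addOn H 1)) := by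
  refine streamBounded_of_totalChange_le fun i => ?_
  have h1 := totalChange_addOn_le F 1 i
  have h2 := totalChange_addOn_le G (-1) i
  have h3 := totalChange_addOn_le H 1 i
  rw [totalChange_append, totalChange_append]
  norm_num at h1 h2 h3 ⊢
  linarith

theorem hammingNorm_addOn {F G H : Finset (Fin n)} (hG : G ⊆ F) :
    hammingNorm (streamVector (addOn F 1 ++ (addOn G (-1) ++ addOn H 1))) =
      ((F \ G) ∪ H).card := by
  classical
  unfold hammingNorm
  congr 1
  ext i
  simp only [Finset.mem_filter, Finset.mem_univ, true_and, streamVector_append, streamVector_addOn,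
    Finset.mem_union, Finset.mem_sdiff]
  have := @hG i
  by_cases h1 : i ∈ F <;> by_cases h2 : i ∈ G <;> by_cases h3 : i ∈ H <;> simp_all

variable {J k : ℕ}

/-- The coordinates for the lower bound: for each `q = (j, i)` and each bit there are blocks of
which the first `2 ^ j` coordinates are used. -/
abbrev BlockIndex (J k : ℕ) : Type := (Fin J × Fin k) × Bool × Fin (2 ^ J)

/-- The used coordinates of the blocks for a set of pairs of indices and bits. -/
noncomputable def blocks (P : Fin J × Fin k → Bool → Prop) :
    Finset (Fin (Fintype.card (BlockIndex J k))) := by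
  classical
  exact Finset.univ.filter fun i =>
    P ((Fintype.equivFin (BlockIndex J k)).symm i).1 ((Fintype.equivFin _).symm i).2.1 ∧
      (((Fintype.equivFin (BlockIndex J k)).symm i).2.2 : ℕ) <
        2 ^ (((Fintype.equivFin (BlockIndex J k)).symm i).1.1 : ℕ)

theorem mem_blocks {P : Fin J × Fin k → Bool → Prop} {c : BlockIndex J k} :
    Fintype.equivFin (BlockIndex J k) c ∈ blocks P ↔
      P c.1 c.2.1 ∧ (c.2.2 : ℕ) < 2 ^ (c.1.1 : ℕ) := by
  simp [blocks]

theorem card_blocks (P : Fin J × Fin k → Bool → Prop) [∀ q b, Decidable (P q b)] :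
    (blocks P).card = ∑ q : Fin J × Fin k, ∑ b, if P q b then 2 ^ (q.1 : ℕ) else 0 := by
  classical
  have h1 : (blocks P).card = (Finset.univ.filter fun c : BlockIndex J k =>
      P c.1 c.2.1 ∧ (c.2.2 : ℕ) < 2 ^ (c.1.1 : ℕ)).card := by
    rw [← Finset.card_map (Fintype.equivFin (BlockIndex J k)).toEmbedding]
    congr 1
    ext i
    obtain ⟨c, rfl⟩ := (Fintype.equivFin (BlockIndex J k)).surjective i
    rw [mem_blocks]
    simp
  rw [h1, Finset.card_filter, Fintype.sum_prod_type]
  refine Finset.sum_congr rfl fun q _ => ?_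
  rw [Fintype.sum_prod_type]
  refine Finset.sum_congr rfl fun b _ => ?_
  by_cases hP : P q b
  · simp only [hP, true_and, if_true]
    rw [← Finset.card_filter, Fin.card_filter_val_lt]
    exact min_eq_right (Nat.pow_le_pow_right two_pos q.1.2.le)
  · simp [hP]

theorem eq_of_forall_equivFin_mem_iff {F G : Finset (Fin (Fintype.card (BlockIndex J k)))}
    (h : ∀ c, Fintype.equivFin (BlockIndex J k) c ∈ F ↔ Fintype.equivFin (BlockIndex J k) c ∈ G) :
    F = G := by
  ext i
  obtain ⟨c, rfl⟩ := (Fintype.equivFin (BlockIndex J k)).surjective i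
  exact h c

/-- The number of used coordinates in the blocks that a vector selects for the first indices up to
that of `q`. -/
def baseNorm (q : Fin J × Fin k) : ℕ :=
  ∑ q' : Fin J × Fin k, if q'.1 ≤ q.1 then 2 ^ (q'.1 : ℕ) else 0

/-- Blocks with smaller first index form a geometric series, so all that survives the deletion is
within a factor `2 * k` of the queried block. -/
theorem baseNorm_le (q : Fin J × Fin k) : baseNorm q ≤ k * (2 * 2 ^ (q.1 : ℕ)) := by
  have h1 : ∑ j : Fin J, (if j ≤ q.1 then 2 ^ (j : ℕ) else 0) ≤ 2 * 2 ^ (q.1 : ℕ) := by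
    have h2 : ∑ j : Fin J, (if j ≤ q.1 then 2 ^ (j : ℕ) else 0) =
        ∑ j ∈ Finset.range J, if j ≤ (q.1 : ℕ) then 2 ^ j else 0 :=
      Fin.sum_univ_eq_sum_range (fun j => if j ≤ (q.1 : ℕ) then 2 ^ j else 0) J
    rw [h2, ← Finset.sum_filter]
    calc ∑ j ∈ (Finset.range J).filter (· ≤ (q.1 : ℕ)), 2 ^ j
        ≤ ∑ j ∈ Finset.range ((q.1 : ℕ) + 1), 2 ^ j := by
          refine Finset.sum_le_sum_of_subset fun j hj => ?_
          have := (Finset.mem_filter.1 hj).2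
          exact Finset.mem_range.2 (by omega)
      _ ≤ 2 * 2 ^ (q.1 : ℕ) := by
          rw [Nat.geomSum_eq le_rfl, pow_succ]
          omega
  unfold baseNorm
  rw [Fintype.sum_prod_type]
  simp only [Finset.sum_const, Finset.card_univ, Fintype.card_fin, smul_eq_mul, ← Finset.mul_sum]
  exact Nat.mul_le_mul_left _ h1

/-- The stream for a vector of bits. -/
noncomputable def bitStream (x : Fin J × Fin k → Bool) :
    List (Update (Fintype.card (BlockIndex J k))) := addOn (blocks fun q b => b = x q) 1

/-- The stream that removes the blocks with first index larger than that of `q`, and adds the block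
for `q` and the bit `true`. -/
noncomputable def queryStream (q : Fin J × Fin k) (x : Fin J × Fin k → Bool) :
    List (Update (Fintype.card (BlockIndex J k))) :=
  addOn (blocks fun q' b => q.1 < q'.1 ∧ b = x q') (-1) ++
    addOn (blocks fun q' b => q' = q ∧ b = true) 1

theorem queryStream_congr (q : Fin J × Fin k) (x y : Fin J × Fin k → Bool)
    (h : ∀ q', q.1 < q'.1 → x q' = y q') : queryStream q x = queryStream q y := by
  have h1 : (fun (q' : Fin J × Fin k) (b : Bool) => q.1 < q'.1 ∧ b = x q') =
      fun q' b => q.1 < q'.1 ∧ b = y q' := by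
    funext q' b
    exact propext (and_congr_right fun hq => by rw [h q' hq])
  unfold queryStream
  rw [h1]

/-- The added block for `true` is already present if the bit is `true`, where it only raises entries
from `1` to `2`; otherwise it contributes fresh coordinates. -/
theorem hammingNorm_bitStream_queryStream (q : Fin J × Fin k) (x : Fin J × Fin k → Bool) :
    hammingNorm (streamVector (bitStream x ++ queryStream q x)) =
      baseNorm q + if x q then 0 else 2 ^ (q.1 : ℕ) := by
  classical
  have hsub : (blocks fun q' b => q.1 < q'.1 ∧ b = x q') ⊆ blocks fun q b => b = x q := by
    intro i
    obtain ⟨c, rfl⟩ := (Fintype.equivFin (BlockIndex J k)).surjective i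
    rw [mem_blocks, mem_blocks]
    exact fun h => ⟨h.1.2, h.2⟩
  have hunion : ((blocks fun q b => b = x q) \ (blocks fun q' b => q.1 < q'.1 ∧ b = x q')) ∪
      (blocks fun q' b => q' = q ∧ b = true) =
      blocks fun q' b => (q'.1 ≤ q.1 ∧ b = x q') ∨ (q' = q ∧ b = true) := by
    refine eq_of_forall_equivFin_mem_iff fun c => ?_
    simp only [Finset.mem_union, Finset.mem_sdiff, mem_blocks, ← not_lt (a := q.1)]
    tauto
  unfold bitStream queryStream
  rw [hammingNorm_addOn hsub, hunion, card_blocks]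
  have hterm : ∀ q' : Fin J × Fin k,
      (∑ b, if (q'.1 ≤ q.1 ∧ b = x q') ∨ (q' = q ∧ b = true) then 2 ^ (q'.1 : ℕ) else 0) =
      (if q'.1 ≤ q.1 then 2 ^ (q'.1 : ℕ) else 0) +
        if q' = q then (if x q then 0 else 2 ^ (q.1 : ℕ)) else 0 := by
    intro q'
    by_cases hq : q' = q
    · subst hq
      cases x q'
      · simp [two_mul]
      · simp
    · cases x q' <;> simp [hq]
  simp only [hterm, Finset.sum_add_distrib, Finset.sum_ite_eq', Finset.mem_univ, if_true]
  rfl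

/-- A one-pass machine needs `Ω(log n / ε)` bits. -/
theorem StreamMachine.EstimatesL0.le_bits {T : StreamMachine (Fintype.card (BlockIndex J k))}
    {ε : ℝ} (hT : T.EstimatesL0 1 0.8 3 ε) (hε0 : 0 < ε) (hε : ε * (4 * k + 1) < 1) :
    J * k ≤ 100 * T.bits := by
  refine T.le_bits_of_separates bitStream queryStream queryStream_congr
    (fun q => (1 + ε) * baseNorm q) fun x q => ?_
  refine (hT _ (streamBounded_addOn _ _ _)).trans (MeasureTheory.measure_mono ?_)
  change {Z : ℝ | (1 - ε) * (hammingNorm (streamVector (bitStream x ++ queryStream q x)) : ℝ) ≤ Z ∧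
    Z ≤ (1 + ε) * (hammingNorm (streamVector (bitStream x ++ queryStream q x)) : ℝ)} ⊆ _
  rw [hammingNorm_bitStream_queryStream]
  rintro Z ⟨h1, h2⟩
  cases hx : x q
  · simp only [hx, Bool.false_eq_true, if_false] at h1 h2 ⊢
    push_cast at h1 h2
    have h3 : (baseNorm q : ℝ) ≤ k * (2 * 2 ^ (q.1 : ℕ)) := by exact_mod_cast baseNorm_le q
    have h4 : (0 : ℝ) < 2 ^ (q.1 : ℕ) := by positivity
    simp only [Set.mem_compl_iff, Set.mem_ofPred_eq, not_le]
    refine lt_of_lt_of_le ?_ h1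
    -- Separation needs `2 * ε * baseNorm q + ε * 2 ^ j < 2 ^ j` with `baseNorm q ≤ 2 * k * 2 ^ j`,
    -- which is the hypothesis on `ε`.
    have h5 : ε * (4 * k + 1) * 2 ^ (q.1 : ℕ) < 1 * 2 ^ (q.1 : ℕ) := by gcongr
    have h6 : ε * (baseNorm q : ℝ) ≤ ε * (k * (2 * 2 ^ (q.1 : ℕ))) := by gcongr
    linarith
  · simpa [hx] using h2

end HardStreams

/-! ### Separation of one pass from two passes -/

theorem not_solvableWithinTwoPassBound_one : ¬ SolvableWithinTwoPassBound 1 := by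
  rintro ⟨ε₀, hε₀, A, hA, C, hC⟩
  -- `k` is chosen to beat the constant `C` at `log n ≤ 2 * J + log (2 * k)`; then `ε` of order at
  -- most `1 / k` is fixed, and finally `J` is taken so large that the remaining terms `W`, which do
  -- not depend on `J`, are negligible.
  obtain ⟨k, hk⟩ := exists_nat_gt (100 * (2 * |C| + 1))
  have hkpos : (0 : ℝ) < k := lt_of_le_of_lt (by positivity) hk
  have hk1 : (1 : ℝ) ≤ k := by exact_mod_cast Nat.pos_of_ne_zero (by rintro rfl; simp at hkpos)
  set ε : ℝ := min (ε₀ / 2) (1 / (8 * k)) with hε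
  have hε0 : 0 < ε := lt_min (by positivity) (by positivity)
  have hεε₀ : ε < ε₀ := (min_le_left _ _).trans_lt (by linarith)
  have hεk : ε * (8 * k) ≤ 1 := by
    rw [← le_div_iff₀ (by positivity)]
    exact min_le_right _ _
  have hε1 : ε ≤ 1 := by nlinarith
  set W : ℝ := Real.log (2 * k) +
    (ε ^ 2)⁻¹ * Real.log (Real.log 3) * (Real.log (1 / ε) + Real.log (Real.log 3)) with hW
  obtain ⟨J, hJ⟩ := exists_nat_gt (|C| * |W|)
  have hJpos : (0 : ℝ) < J := lt_of_le_of_lt (by positivity) hJ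
  set n := Fintype.card (BlockIndex J k)
  have hcard : (n : ℝ) = 2 * k * (J * 2 ^ J) := by
    simp only [n, Fintype.card_prod, Fintype.card_fin, Fintype.card_bool]
    push_cast
    ring
  have hlogn : Real.log n ≤ Real.log (2 * k) + 2 * J := by
    rw [hcard, Real.log_mul (by positivity) (by positivity),
      Real.log_mul hJpos.ne' (by positivity), Real.log_pow]
    have h1 := Real.log_le_sub_one_of_pos hJpos
    have h2 := Real.log_two_lt_d9
    nlinarith
  have hu := log_log_three_pos
  have hv : 0 ≤ Real.log (1 / ε) := Real.log_nonneg (by rwa [le_div_iff₀ hε0, one_mul])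
  have hbits := hC n 3 ε le_rfl hε0 hεε₀
  have hest : (A n 3 ε).EstimatesL0 1 0.8 3 ε := fun σ hσ => hA n 3 ε hε0 hεε₀ σ hσ
  have hlow : ((J * k : ℕ) : ℝ) ≤ ((100 * (A n 3 ε).bits : ℕ) : ℝ) := by
    exact_mod_cast hest.le_bits hε0 (by nlinarith)
  push_cast at hlow
  have hbound : twoPassBound n 3 ε ≤ 2 * J + |W| := by
    have := le_abs_self W
    unfold twoPassBound
    push_cast
    linarith
  have hbound0 : 0 ≤ twoPassBound n 3 ε := by
    have := Real.log_natCast_nonneg n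
    unfold twoPassBound
    push_cast
    positivity
  have h1 : ((A n 3 ε).bits : ℝ) ≤ |C| * (2 * J + |W|) :=
    hbits.trans ((mul_le_mul_of_nonneg_right (le_abs_self C) hbound0).trans (by gcongr))
  have h2 : (J : ℝ) * (100 * (2 * |C| + 1)) < J * k := by gcongr
  nlinarith

theorem mainTheorem11 :
    -- two passes
    SolvableWithinTwoPassBound 2 ∧
    -- three passes; the space bound is for `(log log M) ^ 2 = O(log n)`, e.g. `M = poly(n)`
    (∃ ε₀ : ℝ, 0 < ε₀ ∧ ∃ A : StreamAlgorithm, A.EstimatesL0 3 0.75 ε₀ ∧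
      ∀ c : ℝ, ∃ C : ℝ, ∀ (n M : ℕ) (ε : ℝ), 3 ≤ M →
        (Real.log (Real.log M)) ^ 2 ≤ c * Real.log n → 0 < ε → ε < ε₀ →
          ((A n M ε).bits : ℝ) ≤ C * threePassBound n M ε) ∧
    -- separation: one pass does not suffice for the two-pass space bound
    ¬ SolvableWithinTwoPassBound 1 :=
  ⟨solvableWithinTwoPassBound_two, exists_threePass_algorithm, not_solvableWithinTwoPassBound_one⟩
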